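/- Let $\mathbb H^1=\mathbb R^3$, with points $g=(x,y,\sigma)$, be the Heisenberg group with group law $(x,y,\sigma)\circ(x',y',\sigma')=(x+x',\,y+y',\,\sigma+\sigma'+\tfrac12(xy'-yx'))$, identity $e=0$, homogeneous dimension $Q=4$ and Haar (Lebesgue) measure $dg$. Let $X_1=\partial_x-\frac y2\partial_\sigma$, $X_2=\partial_y+\frac x2\partial_\sigma$ be the left-invariant and $\tilde X_1=\partial_x+\frac y2\partial_\sigma$, $\tilde X_2=\partial_y-\frac x2\partial_\sigma$ the right-invariant horizontal vector fields, and put $\Delta_H=X_1^2+X_2^2$, $|\nabla_H u|^2=(X_1u)^2+(X_2u)^2$, $|\tilde\nabla_H u|^2=(\tilde X_1u)^2+(\tilde X_2u)^2$. Consider $$f(x,y,\sigma)=x+6y\sigma-x^3,\qquad f_+=\max(f,0),\quad f_-=\max(-f,0).$$ **Proposition.** The function $f$ is harmonic, i.e. $\Delta_H f=0$ in $\mathbb H^1$, and $$\Delta_H(|\nabla_H f|^2)(x,y,\sigma)=216x^2+144y^2-24\quad\text{on }\mathbb H^1;$$ in particular $\Delta_H(|\nabla_H f|^2)\le 0$ at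 every $(x,y,\sigma)$ with $x^2+y^2\le\frac19$. The operator $-\Delta_H$ has a positive fundamental solution $\Gamma$ with pole at $e$ which is smooth on $\mathbb H^1\setminus\{e\}$, locally integrable, and tends to zero at infinity. Let $\rho$ be the pseudo-gauge $\rho=\Gamma^{-1/(Q-2)}$, $\rho(e)=0$, where $\Gamma$ is any such fundamental solution, or let $\rho$ be the gauge $((x^2+y^2)^2+16\sigma^2)^{1/4}$, and let $B_r=\{g:\rho(g)<r\}$. For either choice of $\rho$ the following holds. 1. For every $0<\alpha<Q$, the left-invariant functional $$r\longmapsto\frac1{r^\alpha}\int_{B_r}\frac{|\nabla_H f(g)|^2}{\rho(g)^{Q-\alpha}}\,|\nabla_H\rho(g)|^2\,dg$$ is finite for every $r>0$ and nonincreasing on $(0,\frac13)$. 2. In contrast, the right-invariant two-phase functional $$r\longmapsto\frac1{r^4}\left(\int_{B_r}\frac{|\tilde\nabla_H f_+(g)|^2}{\rho(g)^{Q-2}}\,|\nabla_H\rho(g)|^2\,dg\right)\left(\int_{B_r}\frac{|\tilde\nabla_H f_-(g)|^2}{\rho(g)^{Q-2}}\,|\nabla_H\rho(g)|^2\,dg\right)$$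 is finite for every $r>0$ and nondecreasing on $(0,\infty)$. -/

import Mathlib

open scoped ContDiff Topology
open MeasureTheory

noncomputable section

namespace Heisenberg

/-- The underlying space of the first Heisenberg group, in logarithmic coordinates `(x, y, σ)`.
Its Haar measure is Lebesgue measure and its identity is `0`. -/
abbrev H1 : Type := ℝ × ℝ × ℝ

/-- The group law of the Heisenberg group:
`(x, y, σ) ∘ (x', y', σ') = (x + x', y + y', σ + σ' + (x y' - y x') / 2)`. -/
def op (g h : H1) : H1 :=
  (g.1 + h.1, g.2.1 + h.2.1, g.2.2 + h.2.2 + (g.1 * h.2.1 - g.2.1 * h.1) / 2)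

/-- The orthonormal basis `e₁, e₂` of the horizontal layer of the Lie algebra. -/
def e (i : Fin 2) : H1 := if i = 0 then (1, 0, 0) else (0, 1, 0)

/-- Left-invariant vector field `X_i f (g) = d/dt f (g ∘ exp (t e_i))` at `t = 0`; in logarithmic
coordinates `exp ζ = ζ`. Thus `X₁ = ∂_x - (y/2) ∂_σ` and `X₂ = ∂_y + (x/2) ∂_σ`. -/
def X (i : Fin 2) (f : H1 → ℝ) (g : H1) : ℝ :=
  deriv (fun t : ℝ => f (op g (t • e i))) 0

/-- Right-invariant vector field `X̃_i f (g) = d/dt f (exp (t e_i) ∘ g)` at `t = 0`. Thus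
`X̃₁ = ∂_x + (y/2) ∂_σ` and `X̃₂ = ∂_y - (x/2) ∂_σ`. -/
def Xr (i : Fin 2) (f : H1 → ℝ) (g : H1) : ℝ :=
  deriv (fun t : ℝ => f (op (t • e i) g)) 0

/-- The left-invariant carré du champ `|∇_H f|²`. -/
def leftCarre (f : H1 → ℝ) (g : H1) : ℝ := ∑ i, (X i f g) ^ 2

/-- The right-invariant carré du champ `|∇̃_H f|²`. -/
def rightCarre (f : H1 → ℝ) (g : H1) : ℝ := ∑ i, (Xr i f g) ^ 2

/-- The horizontal Laplacian `Δ_H f = X₁² f + X₂² f`. -/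
def lap (f : H1 → ℝ) (g : H1) : ℝ := ∑ i, X i (X i f) g

/-- `f` is harmonic: of class `C²` with `Δ_H f = 0` everywhere. -/
def IsHarmonic (f : H1 → ℝ) : Prop := ContDiff ℝ 2 f ∧ ∀ g, lap f g = 0

/-- The homogeneous dimension of the first Heisenberg group. -/
def Q : ℝ := 4

/-- `Γ` is (off the identity, where its value is irrelevant) the positive fundamental solution of
`-Δ_H` with pole at the identity, vanishing at infinity. Since `Δ_H` is formally self-adjoint,
`-Δ_H Γ = δ` in the sense of distributions means `∫ Γ Δ_H φ = -φ(0)` for all test functions. -/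
structure IsFundamentalSolution (Γ : H1 → ℝ) : Prop where
  smooth : ContDiffOn ℝ ∞ Γ {0}ᶜ
  pos : ∀ g, g ≠ 0 → 0 < Γ g
  locallyIntegrable : LocallyIntegrable Γ volume
  tendsto_zero : Filter.Tendsto Γ (Filter.cocompact H1) (𝓝 0)
  neg_lap_eq_dirac : ∀ φ : H1 → ℝ, ContDiff ℝ ∞ φ → HasCompactSupport φ →
    ∫ g, Γ g * lap φ g = -φ 0

open Classical in
/-- The pseudo-gauge `ρ = Γ ^ (-1 / (Q - 2))`, extended by continuity by `ρ(0) = 0`. -/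
def gaugeOf (Γ : H1 → ℝ) (g : H1) : ℝ := if g = 0 then 0 else Γ g ^ (-1 / (Q - 2))

/-- The explicit gauge `N(x, y, σ) = ((x² + y²)² + 16 σ²) ^ (1/4)`. -/
def koranyi (g : H1) : ℝ := ((g.1 ^ 2 + g.2.1 ^ 2) ^ 2 + 16 * g.2.2 ^ 2) ^ (1 / 4 : ℝ)

/-- The pseudo-ball `B_r = {ρ < r}`. -/
def ball (ρ : H1 → ℝ) (r : ℝ) : Set H1 := {g | ρ g < r}

/-- The integrand `ψ / ρ ^ (Q - α) · |∇_H ρ|²`. -/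
def density (ρ : H1 → ℝ) (α : ℝ) (ψ : H1 → ℝ) (g : H1) : ℝ :=
  ψ g / ρ g ^ (Q - α) * leftCarre ρ g

/-- The functional `r ^ (-α) ∫_{B_r} |∇_H f|² / ρ ^ (Q - α) · |∇_H ρ|² dg`. -/
def leftFunctional (ρ : H1 → ℝ) (α : ℝ) (f : H1 → ℝ) (r : ℝ) : ℝ :=
  1 / r ^ α * ∫ g in ball ρ r, density ρ α (leftCarre f) g

/-- The two-phase functional
`r ^ (-4) (∫_{B_r} |∇̃_H u|² / ρ ^ (Q - 2) · |∇_H ρ|² dg) (∫_{B_r} |∇̃_H v|² / ρ ^ (Q - 2) · |∇_H ρ|² dg)`,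
i.e. the product of the two functionals `r ^ (-2) ∫_{B_r} …` of `u` and of `v`. -/
def twoPhase (ρ : H1 → ℝ) (u v : H1 → ℝ) (r : ℝ) : ℝ :=
  1 / r ^ 4 * ((∫ g in ball ρ r, density ρ 2 (rightCarre u) g) *
    ∫ g in ball ρ r, density ρ 2 (rightCarre v) g)

/-- The function `f(x, y, σ) = x + 6 y σ - x³`. -/
def f (g : H1) : ℝ := g.1 + 6 * g.2.1 * g.2.2 - g.1 ^ 3

/-- The positive part `f₊ = max(f, 0)`. -/
def fPos (g : H1) : ℝ := max (f g) 0

/-- The negative part `f₋ = max(-f, 0)`. -/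
def fNeg (g : H1) : ℝ := max (-f g) 0

end Heisenberg

end

/-! Everything reduces to the gauge N = `koranyi`. Write |z|² = x² + y² and P_ε = `gaugeReg ε`, so
that N⁴ = P_0.

Folland's function κ⁻¹N⁻², with κ = `kappa`, is a fundamental solution
(`isFundamentalSolution_fundSol`): -Δ_H of P_ε^(-1/2) is 4ε P_ε^(-3/2), which the dilations turn
into an approximate identity of mass κ. It is the only one (`IsFundamentalSolution.eq_fundSol`): the
difference of two is weakly harmonic and vanishes at infinity; group convolution with a test
function preserves both properties and gives two derivatives along the fields, so the maximum
principle applies. Hence every admissible ρ is bN with b² = κ or b = 1, and only b² ≥ 7/12 matters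
later.

Since |∇_H N|² = |z|²/N², the weight is homogeneous under the anisotropic dilations, whose Jacobian
is l⁴. Weighted integrals of polynomials over balls are therefore explicit in q = r/b.

Left: |∇_H f|² = 1 - 6|z|² + a quartic, and the functional is b⁻²(A₀ - 6A₂q² + A₄q⁴). It decreases
between two radii as soon as A₄ times the sum of the two values of q² is at most 6A₂.
`setIntegral_quartic_le` gives A₄ ≤ (63/4)A₂, and r < 1/3 gives q² ≤ 4/21, which is exactly enough.

Right: the carré du champ is 1 + 6(y² - x²) + a nonnegative quartic. Exchanging x and y removes the
quadratic term. The reflection (x, y, σ) ↦ (-x, y, -σ) changes the sign of f and preserves all the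
rest, so both phases carry half of the total integral, and the functional is the square of a
nonnegative nondecreasing quantity. -/

noncomputable section

namespace Heisenberg

open Set
open scoped ENNReal

/-! ### The horizontal fields as directional derivatives -/

/-- The coefficient vector of the left-invariant field `X i` at `g`. -/
def field (i : Fin 2) (g : H1) : H1 := if i = 0 then (1, 0, -g.2.1 / 2) else (0, 1, g.1 / 2)

@[simp] lemma field_zero (g : H1) : field 0 g = (1, 0, -g.2.1 / 2) := rfl

@[simp] lemma field_one (g : H1) : field 1 g = (0, 1, g.1 / 2) := rfl

lemma e_zero : e 0 = (1, 0, 0) := rfl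

lemma e_one : e 1 = (0, 1, 0) := rfl

lemma op_smul_e (i : Fin 2) (g : H1) (t : ℝ) : op g (t • e i) = g + t • field i g := by
  fin_cases i
  · ext <;> simp [op, e_zero]; ring
  · ext <;> simp [op, e_one]; ring

lemma X_eq_lineDeriv (i : Fin 2) (h : H1 → ℝ) (g : H1) :
    X i h g = lineDeriv ℝ h g (field i g) := by
  simp [X, lineDeriv, op_smul_e]

lemma X_eq_fderiv (i : Fin 2) {h : H1 → ℝ} {g : H1} (hd : DifferentiableAt ℝ h g) :
    X i h g = fderiv ℝ h g (field i g) := by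
  rw [X_eq_lineDeriv, hd.lineDeriv_eq_fderiv]

/-- The coefficients of `X i` are constant along its own flow lines, which are therefore straight;
this makes the derivative along a line equal to `X i` at every time, not only at 0. -/
lemma field_op (i : Fin 2) (g : H1) (t : ℝ) : field i (op g (t • e i)) = field i g := by
  fin_cases i
  · ext <;> simp [op, e_zero]
  · ext <;> simp [op, e_one]

lemma hasDerivAt_comp_op {i : Fin 2} {h : H1 → ℝ} (hd : Differentiable ℝ h) (g : H1) (t : ℝ) :
    HasDerivAt (fun t : ℝ => h (op g (t • e i))) (X i h (op g (t • e i))) t := by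
  rw [X_eq_fderiv i (hd _), field_op]
  have h1 : HasDerivAt (fun t : ℝ => op g (t • e i)) (field i g) t := by
    simp only [op_smul_e]
    simpa using ((hasDerivAt_id t).smul_const (field i g)).const_add g
  exact (hd (op g (t • e i))).hasFDerivAt.comp_hasDerivAt t h1

lemma contDiff_field (i : Fin 2) {n : WithTop ℕ∞} : ContDiff ℝ n (field i) := by
  fin_cases i
  · exact contDiff_const.prodMk (contDiff_const.prodMk
      ((contDiff_snd.fst.neg).div_const 2))
  · exact contDiff_const.prodMk (contDiff_const.prodMk (contDiff_fst.div_const 2))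

lemma X_eq_fderiv_fun (i : Fin 2) {h : H1 → ℝ} (hd : Differentiable ℝ h) :
    X i h = fun g => fderiv ℝ h g (field i g) :=
  funext fun _ => X_eq_fderiv i (hd _)

lemma contDiff_X {i : Fin 2} {h : H1 → ℝ} (hh : ContDiff ℝ ∞ h) : ContDiff ℝ ∞ (X i h) := by
  rw [X_eq_fderiv_fun i (hh.differentiable (by simp))]
  exact (hh.fderiv_right (m := ∞) (by simp)).clm_apply (contDiff_field i)

lemma hasCompactSupport_X {i : Fin 2} {h : H1 → ℝ} (hh : ContDiff ℝ ∞ h)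
    (hc : HasCompactSupport h) : HasCompactSupport (X i h) := by
  rw [X_eq_fderiv_fun i (hh.differentiable (by simp))]
  refine (hc.fderiv ℝ).mono ?_
  intro g hg hz
  exact hg (by simp [hz])

lemma lap_eq (h : H1 → ℝ) (g : H1) : lap h g = X 0 (X 0 h) g + X 1 (X 1 h) g := by
  simp [lap, Fin.sum_univ_two]

lemma leftCarre_eq (h : H1 → ℝ) (g : H1) : leftCarre h g = X 0 h g ^ 2 + X 1 h g ^ 2 := by
  simp [leftCarre, Fin.sum_univ_two]

lemma rightCarre_eq (h : H1 → ℝ) (g : H1) : rightCarre h g = Xr 0 h g ^ 2 + Xr 1 h g ^ 2 := by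
  simp [rightCarre, Fin.sum_univ_two]

/-- `h` has derivative `c` along the field `X i` at `g`. -/
def HasX (i : Fin 2) (h : H1 → ℝ) (c : ℝ) (g : H1) : Prop :=
  HasDerivAt (fun t : ℝ => h (op g (t • e i))) c 0

lemma HasX.eq {i : Fin 2} {h : H1 → ℝ} {c : ℝ} {g : H1} (H : HasX i h c g) : X i h g = c :=
  HasDerivAt.deriv H

lemma op_zero_smul (g : H1) (v : H1) : op g ((0 : ℝ) • v) = g := by
  ext <;> simp [op]

lemma HasX.add {i : Fin 2} {h k : H1 → ℝ} {c d : ℝ} {g : H1} (H : HasX i h c g)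
    (K : HasX i k d g) : HasX i (fun g => h g + k g) (c + d) g :=
  HasDerivAt.add H K

lemma HasX.mul {i : Fin 2} {h k : H1 → ℝ} {c d : ℝ} {g : H1} (H : HasX i h c g)
    (K : HasX i k d g) : HasX i (fun g => h g * k g) (c * k g + h g * d) g := by
  have := HasDerivAt.mul H K
  rw [op_zero_smul] at this
  exact this

lemma HasX.pow {i : Fin 2} {h : H1 → ℝ} {c : ℝ} {g : H1} (H : HasX i h c g) (n : ℕ) :
    HasX i (fun g => h g ^ n) (n * h g ^ (n - 1) * c) g := by
  have := HasDerivAt.pow H n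
  rw [op_zero_smul] at this
  exact this

lemma HasX.sub {i : Fin 2} {h k : H1 → ℝ} {c d : ℝ} {g : H1} (H : HasX i h c g)
    (K : HasX i k d g) : HasX i (fun g => h g - k g) (c - d) g :=
  HasDerivAt.sub H K

lemma HasX.const (i : Fin 2) (a : ℝ) (g : H1) : HasX i (fun _ => a) 0 g :=
  hasDerivAt_const _ _

lemma HasX.rpow {i : Fin 2} {h : H1 → ℝ} {c : ℝ} {g : H1} (H : HasX i h c g) (p : ℝ)
    (hg : h g ≠ 0) : HasX i (fun g => h g ^ p) (c * p * h g ^ (p - 1)) g := by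
  have := HasDerivAt.rpow_const (p := p) H (Or.inl (by rwa [op_zero_smul]))
  rw [op_zero_smul] at this
  exact this

lemma hasX_x (i : Fin 2) (g : H1) : HasX i (fun g => g.1) (field i g).1 g := by
  simp only [HasX, op_smul_e]
  simpa using ((hasDerivAt_id (0:ℝ)).mul_const (field i g).1).const_add g.1

lemma hasX_y (i : Fin 2) (g : H1) : HasX i (fun g => g.2.1) (field i g).2.1 g := by
  simp only [HasX, op_smul_e]
  simpa using ((hasDerivAt_id (0:ℝ)).mul_const (field i g).2.1).const_add g.2.1

lemma hasX_σ (i : Fin 2) (g : H1) : HasX i (fun g => g.2.2) (field i g).2.2 g := by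
  simp only [HasX, op_smul_e]
  simpa using ((hasDerivAt_id (0:ℝ)).mul_const (field i g).2.2).const_add g.2.2

/-! ### The harmonic polynomial -/

lemma hasX_f (i : Fin 2) (g : H1) : HasX i f ((field i g).1 + (6 * (field i g).2.1 * g.2.2 +
    6 * g.2.1 * (field i g).2.2) - 3 * g.1 ^ 2 * (field i g).1) g := by
  have := ((hasX_x i g).add ((((HasX.const i 6 g).mul (hasX_y i g))).mul (hasX_σ i g))).sub
    ((hasX_x i g).pow 3)
  refine HasDerivAt.congr_deriv this ?_
  norm_num

lemma X_zero_f : X 0 f = fun g => 1 - 3 * (g.1 ^ 2 + g.2.1 ^ 2) := by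
  funext g
  rw [(hasX_f 0 g).eq]
  simp only [field_zero]; ring

lemma X_one_f : X 1 f = fun g => 6 * g.2.2 + 3 * (g.1 * g.2.1) := by
  funext g
  rw [(hasX_f 1 g).eq]
  simp only [field_one]; ring

lemma contDiff_f {n : WithTop ℕ∞} : ContDiff ℝ n f := by
  unfold f; fun_prop

lemma hasX_X_zero_f (i : Fin 2) (g : H1) : HasX i (fun g => 1 - 3 * (g.1 ^ 2 + g.2.1 ^ 2))
    (- 3 * (2 * g.1 * (field i g).1 + 2 * g.2.1 * (field i g).2.1)) g := by
  have := (HasX.const i 1 g).sub ((HasX.const i 3 g).mul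
    (((hasX_x i g).pow 2).add ((hasX_y i g).pow 2)))
  refine HasDerivAt.congr_deriv this ?_
  norm_num

lemma hasX_X_one_f (i : Fin 2) (g : H1) : HasX i (fun g => 6 * g.2.2 + 3 * (g.1 * g.2.1))
    (6 * (field i g).2.2 + 3 * ((field i g).1 * g.2.1 + g.1 * (field i g).2.1)) g := by
  have := ((HasX.const i 6 g).mul (hasX_σ i g)).add ((HasX.const i 3 g).mul
    ((hasX_x i g).mul (hasX_y i g)))
  refine HasDerivAt.congr_deriv this ?_
  norm_num

lemma isHarmonic_f : IsHarmonic f := by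
  refine ⟨contDiff_f, fun g => ?_⟩
  rw [lap_eq, X_zero_f, X_one_f, (hasX_X_zero_f 0 g).eq, (hasX_X_one_f 1 g).eq]
  simp only [field_zero, field_one]; ring

lemma leftCarre_f : leftCarre f = fun g =>
    (1 - 3 * (g.1 ^ 2 + g.2.1 ^ 2)) ^ 2 + (6 * g.2.2 + 3 * (g.1 * g.2.1)) ^ 2 := by
  funext g
  rw [leftCarre_eq, X_zero_f, X_one_f]

lemma X_leftCarre_f (i : Fin 2) : X i (leftCarre f) = fun g =>
    (2 * (1 - 3 * (g.1 ^ 2 + g.2.1 ^ 2))) *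
      (- 3 * (2 * g.1 * (field i g).1 + 2 * g.2.1 * (field i g).2.1)) +
    (2 * (6 * g.2.2 + 3 * (g.1 * g.2.1))) *
      (6 * (field i g).2.2 + 3 * ((field i g).1 * g.2.1 + g.1 * (field i g).2.1)) := by
  funext g
  rw [leftCarre_f, HasX.eq (((hasX_X_zero_f i g).pow 2).add ((hasX_X_one_f i g).pow 2))]
  norm_num

lemma lap_leftCarre_f (x y σ : ℝ) :
    lap (leftCarre f) (x, y, σ) = 216 * x ^ 2 + 144 * y ^ 2 - 24 := by
  set g : H1 := (x, y, σ) with hg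
  have h0 : X 0 (leftCarre f) = fun g => (1 - 3 * (g.1 ^ 2 + g.2.1 ^ 2)) * (-12 * g.1) := by
    rw [X_leftCarre_f]; funext g; simp only [field_zero]; ring
  have h1 : X 1 (leftCarre f) = fun g => (1 - 3 * (g.1 ^ 2 + g.2.1 ^ 2)) * (-12 * g.2.1) +
      (6 * g.2.2 + 3 * (g.1 * g.2.1)) * (12 * g.1) := by
    rw [X_leftCarre_f]; funext g; simp only [field_one]; ring
  rw [lap_eq, h0, h1,
    ((hasX_X_zero_f 0 g).mul ((HasX.const 0 (-12) g).mul (hasX_x 0 g))).eq,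
    (((hasX_X_zero_f 1 g).mul ((HasX.const 1 (-12) g).mul (hasX_y 1 g))).add
      ((hasX_X_one_f 1 g).mul ((HasX.const 1 12 g).mul (hasX_x 1 g)))).eq]
  simp only [field_zero, field_one, hg]
  ring

/-! ### The regularised gauge -/

/-- The square of the norm of the horizontal coordinates. -/
def horSq (g : H1) : ℝ := g.1 ^ 2 + g.2.1 ^ 2

/-- The regularisation `(x² + y² + ε)² + 16 σ²` of the fourth power of the gauge. -/
def gaugeReg (ε : ℝ) (g : H1) : ℝ := (horSq g + ε) ^ 2 + 16 * g.2.2 ^ 2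

lemma horSq_nonneg (g : H1) : 0 ≤ horSq g := by unfold horSq; positivity

lemma gaugeReg_pos_of_pos {ε : ℝ} (hε : 0 < ε) (g : H1) : 0 < gaugeReg ε g := by
  have := horSq_nonneg g
  unfold gaugeReg; positivity

lemma gaugeReg_zero_pos {g : H1} (hg : g ≠ 0) : 0 < gaugeReg 0 g := by
  have h0 : 0 ≤ gaugeReg 0 g := by unfold gaugeReg; positivity
  refine lt_of_le_of_ne h0 fun h => hg ?_
  unfold gaugeReg horSq at h
  have h1 : g.2.2 = 0 := by nlinarith [sq_nonneg (g.1 ^ 2 + g.2.1 ^ 2 + 0), sq_nonneg g.2.2]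
  have h2 : g.1 ^ 2 + g.2.1 ^ 2 = 0 := by rw [h1] at h; nlinarith
  have h3 : g.1 = 0 := by nlinarith [sq_nonneg g.1, sq_nonneg g.2.1]
  have h4 : g.2.1 = 0 := by nlinarith [sq_nonneg g.1, sq_nonneg g.2.1]
  ext <;> simp [h1, h3, h4]

lemma contDiff_horSq {n : WithTop ℕ∞} : ContDiff ℝ n horSq := by
  unfold horSq; fun_prop

lemma contDiff_gaugeReg (ε : ℝ) {n : WithTop ℕ∞} : ContDiff ℝ n (gaugeReg ε) := by
  unfold gaugeReg horSq; fun_prop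

lemma hasX_horSq (i : Fin 2) (g : H1) : HasX i horSq
    (2 * g.1 * (field i g).1 + 2 * g.2.1 * (field i g).2.1) g := by
  refine HasDerivAt.congr_deriv (((hasX_x i g).pow 2).add ((hasX_y i g).pow 2)) ?_
  norm_num

lemma hasX_gaugeReg (ε : ℝ) (i : Fin 2) (g : H1) : HasX i (gaugeReg ε)
    (2 * (horSq g + ε) * (2 * g.1 * (field i g).1 + 2 * g.2.1 * (field i g).2.1)
      + 32 * g.2.2 * (field i g).2.2) g := by
  refine HasDerivAt.congr_deriv ((((hasX_horSq i g).add (HasX.const i ε g)).pow 2).add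
    ((HasX.const i 16 g).mul ((hasX_σ i g).pow 2))) ?_
  norm_num; ring

/-- Positivity of this constant makes `horSq` the strictly subharmonic perturbation in the maximum
principle. -/
lemma lap_horSq (g : H1) : lap horSq g = 4 := by
  have h0 : X 0 horSq = fun g => 2 * g.1 := by
    funext g; rw [(hasX_horSq 0 g).eq]; simp
  have h1 : X 1 horSq = fun g => 2 * g.2.1 := by
    funext g; rw [(hasX_horSq 1 g).eq]; simp
  rw [lap_eq, h0, h1, ((HasX.const 0 2 g).mul (hasX_x 0 g)).eq,
    ((HasX.const 1 2 g).mul (hasX_y 1 g)).eq]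
  simp; norm_num

lemma X_zero_gaugeReg (ε : ℝ) : X 0 (gaugeReg ε) = fun g =>
    4 * (g.1 * (horSq g + ε)) + (-16) * (g.2.1 * g.2.2) := by
  funext g; rw [(hasX_gaugeReg ε 0 g).eq]; simp only [field_zero]; ring

lemma X_one_gaugeReg (ε : ℝ) : X 1 (gaugeReg ε) = fun g =>
    4 * (g.2.1 * (horSq g + ε)) + 16 * (g.1 * g.2.2) := by
  funext g; rw [(hasX_gaugeReg ε 1 g).eq]; simp only [field_one]; ring

/-- For ε = 0 this yields |∇_H N|² = |z|²/N²; for ε > 0 it produces the cancellation in Folland's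
identity. -/
lemma leftCarre_gaugeReg (ε : ℝ) (g : H1) :
    leftCarre (gaugeReg ε) g = 16 * horSq g * gaugeReg ε g := by
  rw [leftCarre_eq, X_zero_gaugeReg, X_one_gaugeReg]
  simp only [gaugeReg, horSq]; ring

lemma lap_gaugeReg (ε : ℝ) (g : H1) : lap (gaugeReg ε) g = 24 * horSq g + 8 * ε := by
  rw [lap_eq, X_zero_gaugeReg, X_one_gaugeReg,
    (((HasX.const 0 4 g).mul ((hasX_x 0 g).mul ((hasX_horSq 0 g).add (HasX.const 0 ε g)))).add
      ((HasX.const 0 (-16) g).mul ((hasX_y 0 g).mul (hasX_σ 0 g)))).eq,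
    (((HasX.const 1 4 g).mul ((hasX_y 1 g).mul ((hasX_horSq 1 g).add (HasX.const 1 ε g)))).add
      ((HasX.const 1 16 g).mul ((hasX_x 1 g).mul (hasX_σ 1 g)))).eq]
  simp only [field_zero, field_one, horSq]; ring

lemma hasX_X_gaugeReg (ε : ℝ) (i : Fin 2) (g : H1) :
    HasX i (X i (gaugeReg ε)) (X i (X i (gaugeReg ε)) g) g := by
  have := (hasDerivAt_comp_op (i := i) ((contDiff_X (i := i)
    (contDiff_gaugeReg ε)).differentiable (by simp)) g 0)
  rwa [op_zero_smul] at this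

/-- Folland's identity: `Δ_H` of the regularised fundamental solution. -/
lemma lap_gaugeReg_rpow {ε : ℝ} (hε : 0 < ε) (g : H1) :
    lap (fun g => gaugeReg ε g ^ (-1 / 2 : ℝ)) g = -(4 * ε * gaugeReg ε g ^ (-3 / 2 : ℝ)) := by
  have hpos := gaugeReg_pos_of_pos hε
  have hX : ∀ i, X i (fun g => gaugeReg ε g ^ (-1 / 2 : ℝ)) = fun g =>
      X i (gaugeReg ε) g * (-1 / 2) * gaugeReg ε g ^ (-1 / 2 - 1 : ℝ) := by
    intro i; funext g
    have h := hasX_gaugeReg ε i g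
    rw [(h.rpow (-1 / 2) (hpos g).ne').eq, h.eq]
  have hXX : ∀ i, X i (X i (fun g => gaugeReg ε g ^ (-1 / 2 : ℝ))) g =
      (X i (X i (gaugeReg ε)) g * gaugeReg ε g + (-3 / 2) * X i (gaugeReg ε) g ^ 2) * (-1 / 2)
        * gaugeReg ε g ^ (-1 / 2 - 1 - 1 : ℝ) := by
    intro i
    have h := hasX_gaugeReg ε i g
    rw [hX, (((hasX_X_gaugeReg ε i g).mul (HasX.const i (-1 / 2) g)).mul
      (h.rpow (-1 / 2 - 1) (hpos g).ne')).eq, h.eq]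
    have : gaugeReg ε g ^ (-1 / 2 - 1 : ℝ) = gaugeReg ε g ^ (-1 / 2 - 1 - 1 : ℝ) * gaugeReg ε g := by
      rw [← Real.rpow_add_one (hpos g).ne']; norm_num
    rw [this]; ring
  rw [lap_eq, hXX, hXX]
  have h1 := leftCarre_gaugeReg ε g
  have h2 := lap_gaugeReg ε g
  rw [leftCarre_eq] at h1
  rw [lap_eq] at h2
  have : gaugeReg ε g ^ (-3 / 2 : ℝ) = gaugeReg ε g ^ (-1 / 2 - 1 - 1 : ℝ) * gaugeReg ε g := by
    rw [← Real.rpow_add_one (hpos g).ne']; norm_num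
  rw [this]
  generalize gaugeReg ε g ^ (-1 / 2 - 1 - 1 : ℝ) = z
  -- With P the regularised gauge, P ΔP - (3/2)|∇P|² = P(24|z|² + 8ε) - 24|z|²P = 8εP.
  linear_combination (-1 / 2 * z * gaugeReg ε g) * h2 + (3 / 4 * z) * h1

lemma koranyi_eq (g : H1) : koranyi g = gaugeReg 0 g ^ (1 / 4 : ℝ) := by
  simp [koranyi, gaugeReg, horSq]

lemma gaugeReg_zero_nonneg (g : H1) : 0 ≤ gaugeReg 0 g := by unfold gaugeReg; positivity

lemma koranyi_nonneg (g : H1) : 0 ≤ koranyi g := by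
  rw [koranyi_eq]; exact Real.rpow_nonneg (gaugeReg_zero_nonneg g) _

lemma koranyi_pos {g : H1} (hg : g ≠ 0) : 0 < koranyi g := by
  rw [koranyi_eq]; exact Real.rpow_pos_of_pos (gaugeReg_zero_pos hg) _

lemma koranyi_rpow (g : H1) (β : ℝ) : koranyi g ^ β = gaugeReg 0 g ^ (β / 4) := by
  rw [koranyi_eq, ← Real.rpow_mul (gaugeReg_zero_nonneg g)]; ring_nf

lemma koranyi_pow_four (g : H1) : koranyi g ^ 4 = gaugeReg 0 g := by
  rw [← Real.rpow_natCast, koranyi_rpow]; norm_num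

@[simp] lemma koranyi_zero : koranyi 0 = 0 := by simp [koranyi]

lemma continuous_koranyi : Continuous koranyi := by
  simp only [funext koranyi_eq]
  exact (contDiff_gaugeReg 0 (n := 0)).continuous.rpow_const fun _ => Or.inr (by norm_num)

lemma horSq_le_koranyi_sq (g : H1) : horSq g ≤ koranyi g ^ 2 := by
  refine (pow_le_pow_iff_left₀ (horSq_nonneg g) (by positivity) two_ne_zero).1 ?_
  rw [← pow_mul, koranyi_pow_four, gaugeReg]
  nlinarith [sq_nonneg g.2.2]

lemma leftCarre_const_mul_koranyi (b : ℝ) {g : H1} (hg : g ≠ 0) :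
    leftCarre (fun g => b * koranyi g) g = b ^ 2 * (horSq g * koranyi g ^ (-2 : ℝ)) := by
  have hpos := gaugeReg_zero_pos hg
  have hX : ∀ i, X i (fun g => b * koranyi g) g =
      b * (X i (gaugeReg 0) g * (1 / 4) * gaugeReg 0 g ^ (1 / 4 - 1 : ℝ)) := by
    intro i
    have h := hasX_gaugeReg 0 i g
    simp only [koranyi_eq]
    rw [((HasX.const i b g).mul (h.rpow (1 / 4) hpos.ne')).eq, h.eq]; ring
  have h1 := leftCarre_gaugeReg 0 g
  rw [leftCarre_eq] at h1 ⊢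
  rw [hX, hX, koranyi_rpow]
  have : gaugeReg 0 g ^ (-2 / 4 : ℝ) = (gaugeReg 0 g ^ (1 / 4 - 1 : ℝ)) ^ 2 * gaugeReg 0 g := by
    rw [← Real.rpow_natCast, ← Real.rpow_mul hpos.le, ← Real.rpow_add_one hpos.ne']; norm_num
  rw [this]
  linear_combination (b ^ 2 / 16 * (gaugeReg 0 g ^ (1 / 4 - 1 : ℝ)) ^ 2) * h1

instance : (volume : Measure H1).IsAddHaarMeasure :=
  Measure.prod.instIsAddHaarMeasure (volume : Measure ℝ) (volume : Measure (ℝ × ℝ))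

/-! ### Dilations -/

/-- The anisotropic dilation `(λ x, λ y, λ² σ)`. -/
def dil (l : ℝ) : H1 →ₗ[ℝ] H1 :=
  LinearMap.prodMap (l • LinearMap.id) (LinearMap.prodMap (l • LinearMap.id) (l ^ 2 • LinearMap.id))

@[simp] lemma dil_apply (l : ℝ) (g : H1) : dil l g = (l * g.1, l * g.2.1, l ^ 2 * g.2.2) := rfl

lemma det_dil (l : ℝ) : LinearMap.det (dil l) = l ^ 4 := by
  simp only [dil, LinearMap.det_prodMap, LinearMap.det_smul, LinearMap.det_id,
    Module.finrank_self]
  ring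

lemma continuous_dil (l : ℝ) : Continuous (dil l) := (dil l).continuous_of_finiteDimensional

lemma map_dil {l : ℝ} (hl : 0 < l) :
    Measure.map (dil l) volume = ENNReal.ofReal ((l ^ 4)⁻¹) • (volume : Measure H1) := by
  have hd : LinearMap.det (dil l) ≠ 0 := by rw [det_dil]; positivity
  rw [Measure.map_linearMap_addHaar_eq_smul_addHaar volume hd, det_dil, abs_of_pos (by positivity)]

lemma measurableEmbedding_dil {l : ℝ} (hl : 0 < l) : MeasurableEmbedding (dil l) := by
  refine (continuous_dil l).measurableEmbedding fun g h hgh => ?_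
  simp only [dil_apply, Prod.mk.injEq, mul_right_inj' hl.ne', mul_right_inj' (pow_ne_zero 2 hl.ne')]
    at hgh
  exact Prod.ext hgh.1 (Prod.ext hgh.2.1 hgh.2.2)

lemma integral_comp_dil {l : ℝ} (hl : 0 < l) (h : H1 → ℝ) :
    ∫ g, h (dil l g) = (l ^ 4)⁻¹ * ∫ g, h g := by
  rw [← (measurableEmbedding_dil hl).integral_map, map_dil hl, integral_smul_measure,
    ENNReal.toReal_ofReal (by positivity), smul_eq_mul]

lemma gaugeReg_dil (l ε : ℝ) (g : H1) : gaugeReg (l ^ 2 * ε) (dil l g) = l ^ 4 * gaugeReg ε g := by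
  simp only [gaugeReg, horSq, dil_apply]; ring

lemma koranyi_dil {l : ℝ} (hl : 0 ≤ l) (g : H1) : koranyi (dil l g) = l * koranyi g := by
  have := gaugeReg_dil l 0 g
  rw [mul_zero] at this
  rw [koranyi_eq, koranyi_eq, this, Real.mul_rpow (by positivity) (gaugeReg_zero_nonneg g)]
  congr 1
  rw [← Real.rpow_natCast, ← Real.rpow_mul hl]; norm_num

/-- The integral of a homogeneous function over a gauge ball. -/
lemma setIntegral_ball_of_homogeneous {h : H1 → ℝ} {q m : ℝ} (hq : 0 < q)
    (hh : ∀ g, h (dil q g) = q ^ m * h g) :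
    ∫ g in ball koranyi q, h g = q ^ (m + 4) * ∫ g in ball koranyi 1, h g := by
  have hm : ∀ q, MeasurableSet (ball koranyi q) := fun q =>
    measurableSet_lt continuous_koranyi.measurable measurable_const
  rw [← integral_indicator (hm q), ← integral_indicator (hm 1)]
  have h1 := integral_comp_dil hq ((ball koranyi q).indicator h)
  have h2 : (fun g => (ball koranyi q).indicator h (dil q g)) =
      fun g => q ^ m * (ball koranyi 1).indicator h g := by
    funext g
    have : dil q g ∈ ball koranyi q ↔ g ∈ ball koranyi 1 := by
      simp only [ball, mem_ofPred_eq, koranyi_dil hq.le]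
      constructor <;> intro H <;> nlinarith
    by_cases hg : g ∈ ball koranyi 1
    · rw [indicator_of_mem (this.2 hg), indicator_of_mem hg, hh]
    · rw [indicator_of_notMem (fun H => hg (this.1 H)), indicator_of_notMem hg, mul_zero]
  rw [h2, integral_const_mul] at h1
  have h4 : q ^ (m + 4) = q ^ m * q ^ 4 := by
    rw [Real.rpow_add hq]; norm_cast
  rw [h4]
  field_simp at h1
  linarith

/-! ### Cylindrical and polar coordinates -/

lemma lintegral_comp_const_mul {F : ℝ → ℝ≥0∞} (hF : Measurable F) {a : ℝ} (ha : 0 < a) :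
    ENNReal.ofReal a * ∫⁻ t, F (a * t) = ∫⁻ t, F t := by
  conv_rhs => rw [← Real.smul_map_volume_mul_left ha.ne']
  rw [lintegral_smul_measure, lintegral_map hF (measurable_const_mul a), abs_of_pos ha, smul_eq_mul]

/-- Substitute s = r² in planar polar coordinates: r dr = ds/2, and the angle contributes 2π. -/
lemma lintegral_comp_horizontal {K : ℝ → ℝ≥0∞} (hK : Measurable K) :
    ∫⁻ p : ℝ × ℝ, K (p.1 ^ 2 + p.2 ^ 2) = ENNReal.ofReal Real.pi * ∫⁻ s in Ioi 0, K s := by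
  rw [← lintegral_comp_polarCoord_symm]
  have h1 : ∀ p : ℝ × ℝ, ENNReal.ofReal p.1 • K ((polarCoord.symm p).1 ^ 2 +
      (polarCoord.symm p).2 ^ 2) = ENNReal.ofReal p.1 * K (p.1 ^ 2) * 1 := by
    intro p
    rw [polarCoord_symm_apply, smul_eq_mul, mul_one]
    congr 2
    linear_combination p.1 ^ 2 * Real.sin_sq_add_cos_sq p.2
  have h2 : ∫⁻ s in Ioi 0, K s = ∫⁻ r in Ioi (0 : ℝ), ENNReal.ofReal |2 * r| * K (r ^ 2) := by
    have him : (fun r : ℝ => r ^ 2) '' Ioi 0 = Ioi 0 := by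
      ext s
      constructor
      · rintro ⟨r, hr, rfl⟩
        exact pow_pos (mem_Ioi.1 hr) 2
      · intro hs
        exact ⟨√s, Real.sqrt_pos.2 hs, Real.sq_sqrt (le_of_lt hs)⟩
    conv_lhs => rw [← him]
    rw [lintegral_image_eq_lintegral_abs_deriv_mul measurableSet_Ioi (f' := fun r => 2 * r)]
    · intro r _
      simpa using (hasDerivAt_pow 2 r).hasDerivWithinAt
    · intro r hr t ht h
      exact (pow_left_inj₀ (le_of_lt hr) (le_of_lt ht) two_ne_zero).1 h
  have h3 : ∀ r ∈ Ioi (0 : ℝ), ENNReal.ofReal |2 * r| * K (r ^ 2) =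
      2 * (ENNReal.ofReal r * K (r ^ 2)) := by
    intro r hr
    rw [abs_of_pos (by simpa using hr), ENNReal.ofReal_mul (by norm_num), mul_assoc]; simp
  simp_rw [h1]
  rw [h2, setLIntegral_congr_fun measurableSet_Ioi h3, lintegral_const_mul _ (by fun_prop),
    polarCoord_target, Measure.volume_eq_prod, ← Measure.prod_restrict,
    lintegral_prod_mul (f := fun r : ℝ => ENNReal.ofReal r * K (r ^ 2)) (g := fun _ => 1)
      (by fun_prop) (by fun_prop)]
  simp only [lintegral_const, one_mul, Measure.restrict_apply MeasurableSet.univ, univ_inter,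
    Real.volume_Ioo]
  rw [show Real.pi - -Real.pi = Real.pi * 2 by ring, ENNReal.ofReal_mul Real.pi_pos.le, mul_comm,
    mul_assoc]
  simp

/-- Cylindrical coordinates `s = x² + y²`, `τ = 4 σ`. -/
lemma lintegral_cylindrical {G : ℝ × ℝ → ℝ≥0∞} (hG : Measurable G) :
    ∫⁻ g : H1, G (horSq g, 4 * g.2.2) =
      ENNReal.ofReal (Real.pi / 4) * ∫⁻ p in Ioi (0 : ℝ) ×ˢ univ, G p := by
  have hmG : Measurable fun g : H1 => G (horSq g, 4 * g.2.2) :=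
    hG.comp ((contDiff_horSq (n := 0)).continuous.measurable.prodMk (by fun_prop))
  set K : ℝ → ℝ≥0∞ := fun s => ∫⁻ τ, G (s, τ) with hK
  have hKm : Measurable K := hG.lintegral_prod_right'
  have h4 : ∀ s, ∫⁻ σ, G (s, 4 * σ) = ENNReal.ofReal (1 / 4) * K s := by
    intro s
    have := lintegral_comp_const_mul (F := fun τ => G (s, τ)) (hG.comp measurable_prodMk_left)
      (a := 4) (by norm_num)
    simp only [hK]
    rw [← this, ← mul_assoc, ← ENNReal.ofReal_mul (by norm_num)]
    simp
  calc ∫⁻ g : H1, G (horSq g, 4 * g.2.2)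
      = ∫⁻ x, ∫⁻ y, ∫⁻ σ, G (x ^ 2 + y ^ 2, 4 * σ) := by
        rw [Measure.volume_eq_prod, lintegral_prod _ hmG.aemeasurable]
        refine lintegral_congr fun x => ?_
        rw [Measure.volume_eq_prod]
        exact lintegral_prod (fun p : ℝ × ℝ => G (horSq (x, p), 4 * p.2))
          (hmG.comp measurable_prodMk_left).aemeasurable
    _ = ∫⁻ p : ℝ × ℝ, ENNReal.ofReal (1 / 4) * K (p.1 ^ 2 + p.2 ^ 2) := by
        simp_rw [h4]
        rw [Measure.volume_eq_prod, lintegral_prod _ (by fun_prop)]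
    _ = _ := by
        rw [lintegral_const_mul _ (by fun_prop), lintegral_comp_horizontal hKm, ← mul_assoc,
          ← ENNReal.ofReal_mul (by norm_num), Measure.volume_eq_prod, ← Measure.prod_restrict,
          lintegral_prod _ hG.aemeasurable]
        simp only [Measure.restrict_univ]
        rw [show 1 / 4 * Real.pi = Real.pi / 4 by ring]

/-- Polar coordinates in the half plane `{s > 0}`. -/
lemma lintegral_halfPlane_polar (a : ℝ → ℝ≥0∞) (b : ℝ → ℝ≥0∞) (ha : Measurable a) (hb : Measurable b)
    {G : ℝ × ℝ → ℝ≥0∞}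
    (hG : ∀ R > 0, ∀ θ, 0 < Real.cos θ → G (R * Real.cos θ, R * Real.sin θ) = a R * b θ) :
    ∫⁻ p in Ioi (0 : ℝ) ×ˢ univ, G p =
      (∫⁻ R in Ioi 0, ENNReal.ofReal R * a R) * ∫⁻ θ in Ioo (-(Real.pi / 2)) (Real.pi / 2), b θ := by
  have hms : MeasurableSet (Ioi (0 : ℝ) ×ˢ (univ : Set ℝ)) := measurableSet_Ioi.prod MeasurableSet.univ
  have hpi := Real.pi_pos
  rw [← lintegral_indicator hms, ← lintegral_comp_polarCoord_symm]
  have h1 : ∀ p ∈ polarCoord.target, ENNReal.ofReal p.1 •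
      (Ioi (0 : ℝ) ×ˢ univ).indicator G (polarCoord.symm p) =
      (ENNReal.ofReal p.1 * a p.1) *
        (Ioo (-(Real.pi / 2)) (Real.pi / 2)).indicator b p.2 := by
    intro p hp
    rw [polarCoord_target] at hp
    obtain ⟨hR, hθ1, hθ2⟩ := hp
    rw [polarCoord_symm_apply, smul_eq_mul]
    by_cases hθ : p.2 ∈ Ioo (-(Real.pi / 2)) (Real.pi / 2)
    · have hc := Real.cos_pos_of_mem_Ioo hθ
      rw [indicator_of_mem hθ, indicator_of_mem (by exact ⟨mul_pos hR hc, trivial⟩),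
        hG _ hR _ hc, mul_assoc]
    · have hc : Real.cos p.2 ≤ 0 := by
        by_contra! hc
        apply hθ
        rw [← Real.cos_abs] at hc
        by_contra hθ
        have habs : Real.pi / 2 ≤ |p.2| := by
          by_contra! h
          exact hθ (abs_lt.1 h)
        have := Real.cos_nonpos_of_pi_div_two_le_of_le habs
          (by have := abs_lt.2 ⟨hθ1, hθ2⟩; linarith)
        linarith
      rw [indicator_of_notMem hθ, indicator_of_notMem, mul_zero, mul_zero]
      rintro ⟨h, -⟩
      have h' : 0 < p.1 * Real.cos p.2 := h
      have : (0 : ℝ) < p.1 := hR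
      nlinarith
  rw [setLIntegral_congr_fun polarCoord.open_target.measurableSet h1, polarCoord_target,
    Measure.volume_eq_prod, ← Measure.prod_restrict,
    lintegral_prod_mul (f := fun R : ℝ => ENNReal.ofReal R * a R)
      (g := (Ioo (-(Real.pi / 2)) (Real.pi / 2)).indicator b)
      (by fun_prop) (hb.indicator measurableSet_Ioo).aemeasurable]
  congr 1
  rw [lintegral_indicator measurableSet_Ioo, Measure.restrict_restrict measurableSet_Ioo]
  congr 2
  apply inter_eq_left.2
  exact Ioo_subset_Ioo (by linarith) (by linarith)

/-! ### Integrals of functions of the gauge -/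

lemma measurableSet_ball_koranyi (q : ℝ) : MeasurableSet (ball koranyi q) :=
  measurableSet_lt continuous_koranyi.measurable measurable_const

lemma mem_ball_koranyi_iff {q : ℝ} (hq : 0 ≤ q) (g : H1) :
    g ∈ ball koranyi q ↔ horSq g ^ 2 + (4 * g.2.2) ^ 2 < q ^ 4 := by
  have h : horSq g ^ 2 + (4 * g.2.2) ^ 2 = koranyi g ^ 4 := by
    rw [koranyi_pow_four, gaugeReg]; ring
  rw [h, pow_lt_pow_iff_left₀ (koranyi_nonneg g) hq four_ne_zero]
  rfl

lemma koranyi_rpow_eq (g : H1) (β : ℝ) :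
    koranyi g ^ β = (horSq g ^ 2 + (4 * g.2.2) ^ 2) ^ (β / 4) := by
  rw [koranyi_rpow, gaugeReg]; ring_nf

/-- Integrals over gauge balls of a product of a radial and an angular function. -/
lemma lintegral_ball_koranyi {h : ℝ × ℝ → ℝ} (hh : Measurable h) {a : ℝ → ℝ} {b : ℝ → ℝ}
    (ha : Measurable a) (hb : Measurable b) {q : ℝ} (hq : 0 < q) (ha0 : ∀ R > 0, 0 ≤ a R)
    (hab : ∀ R > 0, ∀ θ, 0 < Real.cos θ → h (R * Real.cos θ, R * Real.sin θ) = a R * b θ) :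
    ∫⁻ g in ball koranyi q, ENNReal.ofReal (h (horSq g, 4 * g.2.2)) =
      ENNReal.ofReal (Real.pi / 4) * ((∫⁻ R in Ioo 0 (q ^ 2), ENNReal.ofReal (R * a R)) *
        ∫⁻ θ in Ioo (-(Real.pi / 2)) (Real.pi / 2), ENNReal.ofReal (b θ)) := by
  set S : Set (ℝ × ℝ) := {p | p.1 ^ 2 + p.2 ^ 2 < q ^ 4} with hS
  have hSm : MeasurableSet S := measurableSet_lt (by fun_prop) measurable_const
  set G : ℝ × ℝ → ℝ≥0∞ := S.indicator fun p => ENNReal.ofReal (h p) with hG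
  have hGm : Measurable G := hh.ennreal_ofReal.indicator hSm
  have h1 : ∫⁻ g in ball koranyi q, ENNReal.ofReal (h (horSq g, 4 * g.2.2)) =
      ∫⁻ g : H1, G (horSq g, 4 * g.2.2) := by
    rw [← lintegral_indicator (measurableSet_ball_koranyi q)]
    refine lintegral_congr fun g => ?_
    by_cases hg : g ∈ ball koranyi q
    · have : (horSq g, 4 * g.2.2) ∈ S := (mem_ball_koranyi_iff hq.le g).1 hg
      rw [indicator_of_mem hg, hG, indicator_of_mem this]
    · have : (horSq g, 4 * g.2.2) ∉ S := fun H => hg ((mem_ball_koranyi_iff hq.le g).2 H)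
      rw [indicator_of_notMem hg, hG, indicator_of_notMem this]
  rw [h1, lintegral_cylindrical hGm, lintegral_halfPlane_polar
    ((Iio (q ^ 2)).indicator fun R => ENNReal.ofReal (a R)) (fun θ => ENNReal.ofReal (b θ))
    (ha.ennreal_ofReal.indicator measurableSet_Iio) hb.ennreal_ofReal]
  · congr 2
    rw [← lintegral_indicator measurableSet_Ioi, ← lintegral_indicator measurableSet_Ioo]
    refine lintegral_congr fun R => ?_
    by_cases h0 : 0 < R
    · by_cases h1 : R < q ^ 2
      · rw [indicator_of_mem (mem_Ioi.2 h0), indicator_of_mem (mem_Iio.2 h1),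
          indicator_of_mem (mem_Ioo.2 ⟨h0, h1⟩), ENNReal.ofReal_mul h0.le]
      · rw [indicator_of_mem (mem_Ioi.2 h0), indicator_of_notMem (fun H => h1 (mem_Iio.1 H)),
          indicator_of_notMem (fun H => h1 (mem_Ioo.1 H).2), mul_zero]
    · rw [indicator_of_notMem (fun H => h0 (mem_Ioi.1 H)),
        indicator_of_notMem (fun H => h0 (mem_Ioo.1 H).1)]
  · intro R hR θ hθ
    have hmem : (R * Real.cos θ, R * Real.sin θ) ∈ S ↔ R ∈ Iio (q ^ 2) := by
      have : (R * Real.cos θ) ^ 2 + (R * Real.sin θ) ^ 2 = R ^ 2 := by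
        linear_combination R ^ 2 * Real.sin_sq_add_cos_sq θ
      simp only [hS, mem_ofPred_eq, mem_Iio, this]
      rw [← pow_lt_pow_iff_left₀ hR.le (by positivity : 0 ≤ q ^ 2) two_ne_zero, ← pow_mul]
    by_cases hRq : R ∈ Iio (q ^ 2)
    · rw [indicator_of_mem hRq, hG, indicator_of_mem (hmem.2 hRq), hab R hR θ hθ,
        ENNReal.ofReal_mul (ha0 R hR)]
    · rw [indicator_of_notMem hRq, hG, indicator_of_notMem (fun H => hRq (hmem.1 H)), zero_mul]

lemma measurable_koranyi_rpow (β : ℝ) : Measurable fun g => koranyi g ^ β :=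
  continuous_koranyi.measurable.pow_const β

/-- Powers of the gauge of exponent `> -Q` are integrable on gauge balls. -/
lemma integrableOn_koranyi_rpow {β : ℝ} (hβ : -4 < β) {q : ℝ} (hq : 0 < q) :
    IntegrableOn (fun g => koranyi g ^ β) (ball koranyi q) := by
  refine ⟨(measurable_koranyi_rpow β).aestronglyMeasurable, ?_⟩
  rw [hasFiniteIntegral_iff_ofReal
    (Filter.Eventually.of_forall fun g => Real.rpow_nonneg (koranyi_nonneg g) β)]
  have h := lintegral_ball_koranyi (h := fun p => (p.1 ^ 2 + p.2 ^ 2) ^ (β / 4))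
    (a := fun R => R ^ (β / 2)) (b := fun _ => 1) (by fun_prop) (by fun_prop) (by fun_prop) hq
    (fun R hR => by positivity) (fun R hR θ _ => by
      have : (R * Real.cos θ) ^ 2 + (R * Real.sin θ) ^ 2 = R ^ (2 : ℝ) := by
        rw [Real.rpow_two]; linear_combination R ^ 2 * Real.sin_sq_add_cos_sq θ
      simp only [this]
      rw [← Real.rpow_mul hR.le, mul_one]; ring_nf)
  simp only [koranyi_rpow_eq]
  rw [h]
  refine ENNReal.mul_lt_top ENNReal.ofReal_lt_top (ENNReal.mul_lt_top ?_ (by simp))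
  -- Here R = N², so N^β = R^(β/2), and the Jacobian R makes the exponent exceed -1 exactly when β >
  -- -4.
  have hi : IntegrableOn (fun R : ℝ => R ^ (β / 2 + 1)) (Ioo 0 (q ^ 2)) :=
    (intervalIntegral.integrableOn_Ioo_rpow_iff (by positivity)).2 (by linarith)
  refine lt_of_le_of_lt (setLIntegral_mono_ae' measurableSet_Ioo
    (Filter.Eventually.of_forall fun R hR => ?_)) hi.2
  rw [mul_comm, ← Real.rpow_add_one hR.1.ne']
  exact Real.ofReal_le_enorm _

/-- The weight `|∇_H N|² / N ^ (Q - α)` of the functionals, away from the identity. -/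
def weight (α : ℝ) (g : H1) : ℝ := horSq g * koranyi g ^ (α - 6)

lemma weight_nonneg (α : ℝ) (g : H1) : 0 ≤ weight α g :=
  mul_nonneg (horSq_nonneg g) (Real.rpow_nonneg (koranyi_nonneg g) _)

lemma measurable_weight (α : ℝ) : Measurable (weight α) :=
  (contDiff_horSq (n := 0)).continuous.measurable.mul (measurable_koranyi_rpow _)

lemma weight_le {α : ℝ} (g : H1) : weight α g ≤ koranyi g ^ (α - 4) := by
  rcases eq_or_ne g 0 with rfl | hg
  · have h0 : weight α 0 = 0 := by simp [weight, horSq]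
    rw [h0]; exact Real.rpow_nonneg (koranyi_nonneg _) _
  · have h := koranyi_pos hg
    have h2 : koranyi g ^ (α - 4) = koranyi g ^ 2 * koranyi g ^ (α - 6) := by
      rw [← Real.rpow_two, ← Real.rpow_add h]; ring_nf
    rw [h2]
    exact mul_le_mul_of_nonneg_right (horSq_le_koranyi_sq g) (by positivity)

lemma norm_le_of_mem_ball {q : ℝ} {g : H1} (hg : g ∈ ball koranyi q) :
    ‖g‖ ≤ q + q ^ 2 := by
  have hq : koranyi g < q := hg
  have h0 := koranyi_nonneg g
  have h1 := horSq_le_koranyi_sq g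
  have h2 : horSq g ≤ q ^ 2 := h1.trans (by gcongr)
  have h3 : gaugeReg 0 g ≤ q ^ 4 := by rw [← koranyi_pow_four]; gcongr
  unfold horSq at h2
  have hx : |g.1| ≤ q := abs_le_of_sq_le_sq (by nlinarith [sq_nonneg g.2.1]) (by linarith)
  have hy : |g.2.1| ≤ q := abs_le_of_sq_le_sq (by nlinarith [sq_nonneg g.1]) (by linarith)
  have hs : |g.2.2| ≤ q ^ 2 := abs_le_of_sq_le_sq (by
    unfold gaugeReg at h3; nlinarith [sq_nonneg (horSq g + 0), sq_nonneg g.2.2]) (by positivity)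
  have hq0 : 0 < q := h0.trans_lt hq
  rw [Prod.norm_def, Prod.norm_def]
  simp only [Real.norm_eq_abs]
  exact max_le (by nlinarith) (max_le (by nlinarith) (by nlinarith))

/-- Locally bounded functions are integrable against the weight on gauge balls. -/
lemma integrableOn_mul_weight {α : ℝ} (hα : 0 < α) {q : ℝ} (hq : 0 < q) {ψ : H1 → ℝ}
    (hψ : Continuous ψ) : IntegrableOn (fun g => ψ g * weight α g) (ball koranyi q) := by
  obtain ⟨C, hC⟩ := (isCompact_closedBall (0 : H1) (q + q ^ 2)).exists_bound_of_continuousOn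
    hψ.continuousOn
  refine Integrable.mono' ((integrableOn_koranyi_rpow (β := α - 4) (by linarith) hq).const_mul C)
    (hψ.measurable.mul (measurable_weight α)).aestronglyMeasurable ?_
  refine (ae_restrict_iff' (measurableSet_ball_koranyi q)).2 (Filter.Eventually.of_forall ?_)
  intro g hg
  have h1 := hC g (by simpa using norm_le_of_mem_ball hg)
  rw [norm_mul, Real.norm_of_nonneg (weight_nonneg α g)]
  exact mul_le_mul h1 (weight_le g) (weight_nonneg α g) ((norm_nonneg _).trans h1)

/-- The vertical and horizontal fourth order moments of the weight. -/
lemma two_mul_setIntegral_vertical (α : ℝ) :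
    2 * ∫ g in ball koranyi 1, (4 * g.2.2) ^ 2 * weight α g =
      ∫ g in ball koranyi 1, horSq g ^ 2 * weight α g := by
  -- Both moments have the same radial factor, which is never evaluated; only the angular integrals
  -- differ.
  have key : ∀ (h : ℝ × ℝ → ℝ) (b : ℝ → ℝ), Continuous h → Continuous b →
      (∀ p, 0 ≤ h p) → (∀ R > 0, ∀ θ, 0 < Real.cos θ →
        h (R * Real.cos θ, R * Real.sin θ) * Real.cos θ = R ^ 2 * b θ) →
      (∀ θ ∈ Ioo (-(Real.pi / 2)) (Real.pi / 2), 0 ≤ b θ) →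
      ∫ g in ball koranyi 1, h (horSq g, 4 * g.2.2) * weight α g =
      (Real.pi / 4) * ((∫⁻ R in Ioo (0:ℝ) (1 ^ 2), ENNReal.ofReal
        (R * (R ^ 3 * R ^ ((α - 6) / 2)))).toReal *
        ∫ θ in (-(Real.pi / 2))..(Real.pi / 2), b θ) := by
    intro h b hh hb h0 hab hb0
    rw [integral_eq_lintegral_of_nonneg_ae
      (Filter.Eventually.of_forall fun g => mul_nonneg (h0 _) (weight_nonneg α g))]
    · have := lintegral_ball_koranyi (h := fun p => h p * (p.1 * (p.1 ^ 2 + p.2 ^ 2) ^ ((α - 6) / 4)))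
        (a := fun R => R ^ 3 * R ^ ((α - 6) / 2)) (b := b) (q := 1) (by fun_prop) (by fun_prop)
        hb.measurable one_pos (fun R hR => by positivity) (fun R hR θ hθ => by
          have h2 : (R * Real.cos θ) ^ 2 + (R * Real.sin θ) ^ 2 = R ^ (2 : ℝ) := by
            rw [Real.rpow_two]; linear_combination R ^ 2 * Real.sin_sq_add_cos_sq θ
          simp only [h2]
          rw [← Real.rpow_mul hR.le, show 2 * ((α - 6) / 4) = (α - 6) / 2 by ring]
          linear_combination R * R ^ ((α - 6) / 2) * hab R hR θ hθ)
      simp only [weight, koranyi_rpow_eq]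
      rw [this, ENNReal.toReal_mul, ENNReal.toReal_mul, ENNReal.toReal_ofReal (by positivity)]
      congr 2
      rw [intervalIntegral.integral_of_le (by linarith [Real.pi_pos]),
        integral_Ioc_eq_integral_Ioo, integral_eq_lintegral_of_nonneg_ae
        ((ae_restrict_iff' measurableSet_Ioo).2 (Filter.Eventually.of_forall hb0))
        hb.aestronglyMeasurable]
    · have : Continuous fun g : H1 => (horSq g, 4 * g.2.2) :=
        (contDiff_horSq (n := 0)).continuous.prodMk (by fun_prop)
      exact ((hh.comp this).measurable.mul (measurable_weight α)).aestronglyMeasurable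
  -- The factor |z|² of the weight contributes one cosine, so the angular functions are sin²θ cos θ
  -- and cos³θ. Writing them as sinᵐ cos²ⁿ⁺¹ allows the substitution u = sin θ, which gives 2/3 and
  -- 4/3.
  rw [key (fun p => p.2 ^ 2) (fun θ => Real.sin θ ^ 2 * Real.cos θ ^ (2 * 0 + 1)) (by fun_prop)
      (by fun_prop) (fun p => by positivity) (fun R hR θ hθ => by ring)
      (fun θ hθ => mul_nonneg (sq_nonneg _) (pow_nonneg (Real.cos_pos_of_mem_Ioo hθ).le _)),
    key (fun p => p.1 ^ 2) (fun θ => Real.sin θ ^ 0 * Real.cos θ ^ (2 * 1 + 1)) (by fun_prop)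
      (by fun_prop) (fun p => by positivity) (fun R hR θ hθ => by ring)
      (fun θ hθ => mul_nonneg (by simp) (pow_nonneg (Real.cos_pos_of_mem_Ioo hθ).le _)),
    integral_sin_pow_mul_cos_pow_odd, integral_sin_pow_mul_cos_pow_odd]
  have h1 : ∫ u in Real.sin (-(Real.pi / 2))..Real.sin (Real.pi / 2), u ^ 2 * (1 - u ^ 2) ^ 0 =
      2 / 3 := by
    simp [integral_pow]; norm_num
  have h2 : ∫ u in Real.sin (-(Real.pi / 2))..Real.sin (Real.pi / 2), u ^ 0 * (1 - u ^ 2) ^ 1 =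
      4 / 3 := by
    simp [integral_pow]; norm_num
  rw [h1, h2]; ring

/-! ### The normalising constant -/

lemma lintegral_gaugeReg_one : ∫⁻ g, ENNReal.ofReal (gaugeReg 1 g ^ (-3 / 2 : ℝ)) =
    ENNReal.ofReal (Real.pi / 4) * ∫⁻ p in Ioi (0 : ℝ) ×ˢ univ,
      ENNReal.ofReal (((p.1 + 1) ^ 2 + p.2 ^ 2) ^ (-3 / 2 : ℝ)) := by
  rw [← lintegral_cylindrical (by fun_prop)]
  refine lintegral_congr fun g => ?_
  simp only [gaugeReg]; ring_nf

/-- In the half plane s > 0, (s + 1)² + τ² ≥ 1 + s² + τ², and (1 + ‖p‖²)^(-3/2) is integrable on the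
plane because 3 > 2. -/
lemma integrable_gaugeReg_one : Integrable fun g => gaugeReg 1 g ^ (-3 / 2 : ℝ) := by
  have hpos := gaugeReg_pos_of_pos one_pos
  refine ⟨((contDiff_gaugeReg 1 (n := 0)).continuous.measurable.pow_const _).aestronglyMeasurable,
    ?_⟩
  rw [hasFiniteIntegral_iff_ofReal
    (Filter.Eventually.of_forall fun g => Real.rpow_nonneg (hpos g).le _), lintegral_gaugeReg_one]
  refine ENNReal.mul_lt_top ENNReal.ofReal_lt_top ?_
  have hi : Integrable (fun p : ℝ × ℝ => ((1 : ℝ) + ‖p‖ ^ 2) ^ (-3 / 2 : ℝ)) :=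
    integrable_rpow_neg_one_add_norm_sq (by simp; norm_num)
  refine lt_of_le_of_lt (setLIntegral_mono_ae' (measurableSet_Ioi.prod MeasurableSet.univ)
    (Filter.Eventually.of_forall fun p hp => ?_)) (lt_of_le_of_lt (setLIntegral_le_lintegral _ _)
    hi.2)
  refine (ENNReal.ofReal_le_ofReal ?_).trans (Real.ofReal_le_enorm _)
  have hp1 : 0 < p.1 := hp.1
  have hn : ‖p‖ ^ 2 ≤ p.1 ^ 2 + p.2 ^ 2 := by
    rw [Prod.norm_def]
    rcases max_choice ‖p.1‖ ‖p.2‖ with h | h <;> rw [h, Real.norm_eq_abs, sq_abs] <;>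
      nlinarith [sq_nonneg p.1, sq_nonneg p.2]
  refine Real.rpow_le_rpow_of_nonpos (by positivity) (by nlinarith) (by norm_num)

/-- The total mass of `-Δ_H` of the regularised kernel. -/
def kappa : ℝ := 4 * ∫ g, gaugeReg 1 g ^ (-3 / 2 : ℝ)

/-- A crude bound, with the constant needed for the radius 1/3. On the box 0 < s < 1, |τ| < 3/2, of
area 3, the base (s + 1)² + τ² is at most (5/2)², so the integrand is at least 8/125; thus κ ≥
24π/125 > 7/12. -/
lemma kappa_ge : 7 / 12 ≤ kappa := by
  have hpos := gaugeReg_pos_of_pos one_pos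
  have hle : ENNReal.ofReal (Real.pi / 4) * (ENNReal.ofReal (8 / 125) * ENNReal.ofReal 3) ≤
      ∫⁻ g, ENNReal.ofReal (gaugeReg 1 g ^ (-3 / 2 : ℝ)) := by
    rw [lintegral_gaugeReg_one]
    gcongr
    calc ENNReal.ofReal (8 / 125) * ENNReal.ofReal 3
        = ∫⁻ _ in Ioo (0 : ℝ) 1 ×ˢ Ioo (-(3 / 2) : ℝ) (3 / 2), ENNReal.ofReal (8 / 125) := by
          rw [setLIntegral_const, Measure.volume_eq_prod, Measure.prod_prod, Real.volume_Ioo,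
            Real.volume_Ioo]
          norm_num
      _ ≤ ∫⁻ p in Ioo (0 : ℝ) 1 ×ˢ Ioo (-(3 / 2) : ℝ) (3 / 2),
            ENNReal.ofReal (((p.1 + 1) ^ 2 + p.2 ^ 2) ^ (-3 / 2 : ℝ)) := by
          refine setLIntegral_mono_ae' (measurableSet_Ioo.prod measurableSet_Ioo)
            (Filter.Eventually.of_forall fun p hp => ENNReal.ofReal_le_ofReal ?_)
          obtain ⟨⟨h1, h2⟩, h3, h4⟩ := hp
          have h5 : (8 / 125 : ℝ) = ((5 / 2) ^ (2 : ℝ)) ^ (-3 / 2 : ℝ) := by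
            rw [← Real.rpow_mul (by norm_num)]
            norm_num [Real.rpow_neg]
          rw [h5]
          refine Real.rpow_le_rpow_of_nonpos (by positivity) ?_ (by norm_num)
          rw [Real.rpow_two]
          nlinarith
      _ ≤ _ := lintegral_mono_set (prod_mono Ioo_subset_Ioi_self (subset_univ _))
  rw [kappa, integral_eq_lintegral_of_nonneg_ae
    (Filter.Eventually.of_forall fun g => Real.rpow_nonneg (hpos g).le _)
    integrable_gaugeReg_one.1]
  have hfin : ∫⁻ g, ENNReal.ofReal (gaugeReg 1 g ^ (-3 / 2 : ℝ)) ≠ ⊤ := by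
    have := integrable_gaugeReg_one.2
    rw [hasFiniteIntegral_iff_ofReal
      (Filter.Eventually.of_forall fun g => Real.rpow_nonneg (hpos g).le _)] at this
    exact this.ne
  have := ENNReal.toReal_mono hfin hle
  rw [← ENNReal.ofReal_mul (by norm_num), ← ENNReal.ofReal_mul (by positivity),
    ENNReal.toReal_ofReal (by positivity)] at this
  nlinarith [Real.pi_gt_d2]

lemma kappa_pos : 0 < kappa := lt_of_lt_of_le (by norm_num) kappa_ge

/-! ### Integration by parts -/

lemma integrable_of_continuous {h : H1 → ℝ} (hh : Continuous h) (hc : HasCompactSupport h) :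
    Integrable h := hh.integrable_of_hasCompactSupport hc

lemma integral_mul_fderiv_eq_zero {c ψ : H1 → ℝ} {v : H1} (hc : ContDiff ℝ ∞ c)
    (hcv : ∀ g, fderiv ℝ c g v = 0) (hψ : ContDiff ℝ ∞ ψ) (hs : HasCompactSupport ψ) :
    Integrable (fun g => c g * fderiv ℝ ψ g v) ∧ ∫ g, c g * fderiv ℝ ψ g v = 0 := by
  have hd : Continuous fun g => fderiv ℝ ψ g v :=
    (hψ.continuous_fderiv (by simp)).clm_apply continuous_const
  have hsd : HasCompactSupport fun g => fderiv ℝ ψ g v :=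
    (hs.fderiv ℝ).mono fun g hg hz => hg (by simp [hz])
  have hi : Integrable (fun g => c g * fderiv ℝ ψ g v) :=
    integrable_of_continuous (hc.continuous.mul hd) hsd.mul_left
  refine ⟨hi, ?_⟩
  rw [integral_mul_fderiv_eq_neg_fderiv_mul_of_integrable (by simp [hcv]) hi
    (integrable_of_continuous (hc.continuous.mul hψ.continuous) hs.mul_left)
    (fun g _ => hc.differentiable (by simp) g) (fun g _ => hψ.differentiable (by simp) g)]
  simp [hcv]

/-- The fields `X i` are divergence free. -/
lemma integral_X_eq_zero (i : Fin 2) {ψ : H1 → ℝ} (hψ : ContDiff ℝ ∞ ψ)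
    (hs : HasCompactSupport ψ) : ∫ g, X i ψ g = 0 := by
  -- The ∂_σ coefficient of `X i` does not depend on σ, so each of the two terms integrates to zero
  -- separately.
  have hdec : ∀ g, X i ψ g = 1 * fderiv ℝ ψ g (e i) + (field i g).2.2 * fderiv ℝ ψ g (0, 0, 1) := by
    intro g
    rw [X_eq_fderiv i (hψ.differentiable (by simp) g), one_mul, ← smul_eq_mul, ← map_smul, ← map_add]
    congr 1
    fin_cases i <;> ext <;> simp [e_zero, e_one]
  have h1 := integral_mul_fderiv_eq_zero (c := fun _ => 1) (v := e i) contDiff_const (by simp) hψ hs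
  have hc : ContDiff ℝ ∞ fun g => (field i g).2.2 := (contDiff_field i).snd.snd
  have h2 := integral_mul_fderiv_eq_zero (v := (0, 0, 1)) hc (fun g => by
    rw [← ((hc.differentiable (by simp)) g).lineDeriv_eq_fderiv]
    fin_cases i <;> simp [lineDeriv]) hψ hs
  simp_rw [hdec]
  rw [integral_add h1.1 h2.1, h1.2, h2.2, add_zero]

lemma hasX_of_contDiff (i : Fin 2) {h : H1 → ℝ} (hh : ContDiff ℝ ∞ h) (g : H1) :
    HasX i h (X i h g) g := by
  have := hasDerivAt_comp_op (i := i) (hh.differentiable (by simp)) g 0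
  rwa [op_zero_smul] at this

lemma continuous_lap {h : H1 → ℝ} (hh : ContDiff ℝ ∞ h) : Continuous (lap h) := by
  simp only [funext (lap_eq h)]
  exact (contDiff_X (contDiff_X hh)).continuous.add (contDiff_X (contDiff_X hh)).continuous

lemma hasCompactSupport_lap {h : H1 → ℝ} (hh : ContDiff ℝ ∞ h) (hs : HasCompactSupport h) :
    HasCompactSupport (lap h) := by
  simp only [funext (lap_eq h)]
  exact (hasCompactSupport_X (contDiff_X hh) (hasCompactSupport_X hh hs)).add
    (hasCompactSupport_X (contDiff_X hh) (hasCompactSupport_X hh hs))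

/-- Green's identity for the horizontal Laplacian. -/
lemma integral_mul_lap {u φ : H1 → ℝ} (hu : ContDiff ℝ ∞ u) (hφ : ContDiff ℝ ∞ φ)
    (hs : HasCompactSupport φ) : ∫ g, u g * lap φ g = ∫ g, φ g * lap u g := by
  have hi : ∀ i, ∫ g, u g * X i (X i φ) g = ∫ g, φ g * X i (X i u) g := by
    intro i
    have hXs := hasCompactSupport_X (i := i) hφ hs
    have hdiff : ∀ g, X i (fun g => u g * X i φ g - φ g * X i u g) g =
        u g * X i (X i φ) g - φ g * X i (X i u) g := by
      intro g
      rw [(((hasX_of_contDiff i hu g).mul (hasX_of_contDiff i (contDiff_X hφ) g)).sub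
        ((hasX_of_contDiff i hφ g).mul (hasX_of_contDiff i (contDiff_X hu) g))).eq]
      ring
    have h0 := integral_X_eq_zero i (ψ := fun g => u g * X i φ g - φ g * X i u g)
      ((hu.mul (contDiff_X hφ)).sub (hφ.mul (contDiff_X hu))) (hXs.mul_left.sub hs.mul_right)
    simp_rw [hdiff] at h0
    rw [integral_sub] at h0
    · linarith
    · exact integrable_of_continuous (hu.continuous.mul (contDiff_X (contDiff_X hφ)).continuous)
        (hasCompactSupport_X (contDiff_X hφ) hXs).mul_left
    · exact integrable_of_continuous (hφ.continuous.mul (contDiff_X (contDiff_X hu)).continuous)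
        hs.mul_right
  have hXs : ∀ i, HasCompactSupport (X i (X i φ)) := fun i =>
    hasCompactSupport_X (contDiff_X hφ) (hasCompactSupport_X hφ hs)
  simp_rw [lap_eq, mul_add]
  rw [integral_add, integral_add, hi, hi]
  · exact integrable_of_continuous (hφ.continuous.mul (contDiff_X (contDiff_X hu)).continuous)
      hs.mul_right
  · exact integrable_of_continuous (hφ.continuous.mul (contDiff_X (contDiff_X hu)).continuous)
      hs.mul_right
  · exact integrable_of_continuous (hu.continuous.mul (contDiff_X (contDiff_X hφ)).continuous)
      (hXs 0).mul_left
  · exact integrable_of_continuous (hu.continuous.mul (contDiff_X (contDiff_X hφ)).continuous)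
      (hXs 1).mul_left

/-! ### The fundamental solution -/

/-- Folland's fundamental solution of `-Δ_H`. -/
def fundSol (g : H1) : ℝ := kappa⁻¹ * koranyi g ^ (-2 : ℝ)

lemma tendsto_koranyi : Filter.Tendsto koranyi (Filter.cocompact H1) Filter.atTop := by
  refine Filter.tendsto_atTop.2 fun b => ?_
  refine Filter.mem_cocompact.2 ⟨Metric.closedBall 0 (b + b ^ 2), isCompact_closedBall _ _, ?_⟩
  intro g hg
  by_contra! h
  simp only [mem_ofPred_eq, not_le] at h
  exact hg (by simpa using norm_le_of_mem_ball (show g ∈ ball koranyi b from h))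

lemma locallyIntegrable_koranyi_rpow {β : ℝ} (hβ : -4 < β) :
    LocallyIntegrable (fun g => koranyi g ^ β) := by
  intro g
  refine ⟨ball koranyi (koranyi g + 1), ?_, integrableOn_koranyi_rpow hβ
    (by linarith [koranyi_nonneg g])⟩
  exact (isOpen_lt continuous_koranyi continuous_const).mem_nhds (show koranyi g < _ by linarith)

lemma contDiff_gaugeReg_rpow {ε : ℝ} (hε : 0 < ε) (p : ℝ) :
    ContDiff ℝ ∞ fun g => gaugeReg ε g ^ p :=
  (contDiff_gaugeReg ε).rpow_const_of_ne fun g => (gaugeReg_pos_of_pos hε g).ne'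

/-- Green's identity moves Δ_H onto the smooth kernel, where Folland's identity applies.
Regularising with ε = l² makes `dil l` carry the result to ε = 1: the powers l², l⁻⁶ and l⁴ cancel.
-/
lemma integral_gaugeReg_mul_lap {l : ℝ} (hl : 0 < l) {φ : H1 → ℝ} (hφ : ContDiff ℝ ∞ φ)
    (hs : HasCompactSupport φ) : ∫ g, gaugeReg (l ^ 2) g ^ (-1 / 2 : ℝ) * lap φ g =
      -(4 * ∫ g, φ (dil l g) * gaugeReg 1 g ^ (-3 / 2 : ℝ)) := by
  have hl2 : 0 < l ^ 2 := by positivity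
  rw [integral_mul_lap (contDiff_gaugeReg_rpow hl2 _) hφ hs]
  simp_rw [lap_gaugeReg_rpow hl2]
  have h := integral_comp_dil hl fun g => φ g * -(4 * l ^ 2 * gaugeReg (l ^ 2) g ^ (-3 / 2 : ℝ))
  have h1 : ∀ g, gaugeReg (l ^ 2) (dil l g) ^ (-3 / 2 : ℝ) =
      (l ^ 6)⁻¹ * gaugeReg 1 g ^ (-3 / 2 : ℝ) := by
    intro g
    have := gaugeReg_dil l 1 g
    rw [mul_one] at this
    rw [this, Real.mul_rpow (by positivity) (gaugeReg_pos_of_pos one_pos g).le]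
    congr 1
    rw [← Real.rpow_natCast, ← Real.rpow_mul hl.le, ← Real.rpow_natCast l 6, ← Real.rpow_neg hl.le]
    norm_num
  have h2 : ∀ g, φ (dil l g) * -(4 * l ^ 2 * gaugeReg (l ^ 2) (dil l g) ^ (-3 / 2 : ℝ)) =
      -(4 * (l ^ 4)⁻¹) * (φ (dil l g) * gaugeReg 1 g ^ (-3 / 2 : ℝ)) := by
    intro g
    rw [h1]; field_simp
  simp_rw [h2] at h
  rw [integral_const_mul] at h
  refine mul_left_cancel₀ (inv_ne_zero (pow_ne_zero 4 hl.ne')) ?_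
  linarith

/-- `gaugeReg ε` increases with ε ≥ 0, so the kernels are dominated by their limit N⁻², which is
locally integrable. -/
lemma tendsto_integral_gaugeReg_mul {ψ : H1 → ℝ} (hψ : Continuous ψ) (hs : HasCompactSupport ψ) :
    Filter.Tendsto (fun l : ℝ => ∫ g, gaugeReg (l ^ 2) g ^ (-1 / 2 : ℝ) * ψ g) (𝓝[>] 0)
      (𝓝 (∫ g, koranyi g ^ (-2 : ℝ) * ψ g)) := by
  refine tendsto_integral_filter_of_dominated_convergence
    (fun g => koranyi g ^ (-2 : ℝ) * ‖ψ g‖) ?_ ?_ ?_ ?_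
  · refine Filter.Eventually.of_forall fun l => ?_
    exact (((contDiff_gaugeReg _ (n := 0)).continuous.measurable.pow_const _).mul
      hψ.measurable).aestronglyMeasurable
  · refine Filter.Eventually.of_forall fun l => ?_
    filter_upwards [compl_mem_ae_iff.2 (measure_singleton (0 : H1))] with g hg
    rw [norm_mul]
    gcongr
    have h0 := gaugeReg_zero_pos hg
    have h1 : gaugeReg 0 g ≤ gaugeReg (l ^ 2) g := by
      unfold gaugeReg
      have := horSq_nonneg g
      gcongr
      positivity
    rw [Real.norm_of_nonneg (Real.rpow_nonneg (h0.le.trans h1) _), koranyi_rpow,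
      show (-2 / 4 : ℝ) = -1 / 2 by norm_num]
    exact Real.rpow_le_rpow_of_nonpos h0 h1 (by norm_num)
  · have hl := locallyIntegrable_koranyi_rpow (β := -2) (by norm_num)
    have := hl.integrable_smul_right_of_hasCompactSupport hψ.norm hs.norm
    simpa [mul_comm] using this
  · filter_upwards [compl_mem_ae_iff.2 (measure_singleton (0 : H1))] with g hg
    refine Filter.Tendsto.mul ?_ tendsto_const_nhds
    rw [koranyi_rpow, show (-2 / 4 : ℝ) = -1 / 2 by norm_num]
    have hc : Continuous fun l : ℝ => gaugeReg (l ^ 2) g := by unfold gaugeReg; fun_prop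
    have := hc.tendsto 0
    simp only [ne_eq, OfNat.ofNat_ne_zero, not_false_eq_true, zero_pow] at this
    exact (this.mono_left nhdsWithin_le_nhds).rpow_const (Or.inl (gaugeReg_zero_pos hg).ne')

lemma tendsto_integral_comp_dil {φ : H1 → ℝ} (hφ : Continuous φ) (hs : HasCompactSupport φ) :
    Filter.Tendsto (fun l : ℝ => ∫ g, φ (dil l g) * gaugeReg 1 g ^ (-3 / 2 : ℝ)) (𝓝[>] 0)
      (𝓝 (∫ g, φ 0 * gaugeReg 1 g ^ (-3 / 2 : ℝ))) := by
  obtain ⟨C, hC⟩ := hs.exists_bound_of_continuous hφ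
  refine tendsto_integral_filter_of_dominated_convergence
    (fun g => C * gaugeReg 1 g ^ (-3 / 2 : ℝ)) ?_ ?_ (integrable_gaugeReg_one.const_mul C) ?_
  · refine Filter.Eventually.of_forall fun l => ?_
    exact ((hφ.comp (continuous_dil l)).mul
      (contDiff_gaugeReg_rpow one_pos _).continuous).aestronglyMeasurable
  · refine Filter.Eventually.of_forall fun l => Filter.Eventually.of_forall fun g => ?_
    rw [norm_mul, Real.norm_of_nonneg (Real.rpow_nonneg (gaugeReg_pos_of_pos one_pos g).le _)]
    exact mul_le_mul_of_nonneg_right (hC _) (Real.rpow_nonneg (gaugeReg_pos_of_pos one_pos g).le _)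
  · refine Filter.Eventually.of_forall fun g => Filter.Tendsto.mul ?_ tendsto_const_nhds
    have hc : Continuous fun l : ℝ => φ (dil l g) := hφ.comp (by simp only [dil_apply]; fun_prop)
    have := hc.tendsto 0
    have h0 : dil 0 g = 0 := by ext <;> simp
    rw [h0] at this
    exact this.mono_left nhdsWithin_le_nhds

theorem isFundamentalSolution_fundSol : IsFundamentalSolution fundSol where
  smooth := by
    unfold fundSol
    simp only [koranyi_rpow]
    exact contDiffOn_const.mul ((contDiff_gaugeReg 0).contDiffOn.rpow_const_of_ne
      fun g hg => (gaugeReg_zero_pos hg).ne')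
  pos g hg := mul_pos (inv_pos.2 kappa_pos) (Real.rpow_pos_of_pos (koranyi_pos hg) _)
  locallyIntegrable :=
    (locallyIntegrable_koranyi_rpow (β := -2) (by norm_num)).smul kappa⁻¹
  tendsto_zero := by
    have := ((tendsto_rpow_neg_atTop (y := 2) (by norm_num)).comp tendsto_koranyi).const_mul kappa⁻¹
    rw [mul_zero] at this
    exact this
  neg_lap_eq_dirac φ hφ hs := by
    have h1 := tendsto_integral_gaugeReg_mul (continuous_lap hφ) (hasCompactSupport_lap hφ hs)
    have h2 := ((tendsto_integral_comp_dil hφ.continuous hs).const_mul 4).neg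
    -- The same integrals tend to ∫ N⁻² Δ_H φ and, after Green's identity and dilation, to -κ φ(0).
    have h3 := tendsto_nhds_unique h1 (h2.congr' (by
      filter_upwards [self_mem_nhdsWithin] with l hl
      rw [integral_gaugeReg_mul_lap hl hφ hs]))
    simp only [fundSol, mul_assoc]
    rw [integral_const_mul, h3, integral_const_mul]
    have := kappa_pos.ne'
    have h4 : ∫ g, gaugeReg 1 g ^ (-3 / 2 : ℝ) = kappa / 4 := by rw [kappa]; ring
    rw [h4]
    field_simp

/-! ### The maximum principle -/

/-- If c were positive, the critical point would also be a local minimum; h would be locally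
constant, forcing c = 0. -/
lemma nonpos_of_isLocalMax {h D : ℝ → ℝ} {c : ℝ} (hD : ∀ t, HasDerivAt h (D t) t)
    (hc : HasDerivAt D c 0) (hm : IsLocalMax h 0) : c ≤ 0 := by
  by_contra! hpos
  have hd : deriv h = D := funext fun t => (hD t).deriv
  have hdd : deriv (deriv h) 0 = c := by rw [hd, hc.deriv]
  have hmin : IsLocalMin h 0 :=
    isLocalMin_of_deriv_deriv_pos (by rw [hdd]; exact hpos) hm.deriv_eq_zero (hD 0).continuousAt
  have heq : h =ᶠ[𝓝 0] fun _ => h 0 := by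
    filter_upwards [hm, hmin] with t h1 h2 using le_antisymm h1 h2
  have := heq.deriv.deriv_eq
  rw [hdd] at this
  simp at this
  exact hpos.ne' this

/-- `U` has second derivatives along the horizontal fields with vanishing sum. -/
def IsWeaklyHarmonic (U : H1 → ℝ) : Prop :=
  ∀ g, ∃ (D : Fin 2 → ℝ → ℝ) (S : Fin 2 → ℝ),
    (∀ i t, HasDerivAt (fun t : ℝ => U (op g (t • e i))) (D i t) t) ∧
    (∀ i, HasDerivAt (D i) (S i) 0) ∧ S 0 + S 1 = 0

lemma continuous_op_smul (g : H1) (i : Fin 2) : Continuous fun t : ℝ => op g (t • e i) := by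
  simp only [op_smul_e]; fun_prop

/-- A positive value m would survive in U + d|z|² for small d > 0 and give an interior maximum,
where both second derivatives along the fields are nonpositive although their sum is 4d. -/
lemma IsWeaklyHarmonic.nonpos {U : H1 → ℝ} (hU : IsWeaklyHarmonic U) (hc : Continuous U)
    (h0 : Filter.Tendsto U (Filter.cocompact H1) (𝓝 0)) (g : H1) : U g ≤ 0 := by
  by_contra! hpos
  set m := U g with hm
  obtain ⟨K, hK, hKU⟩ := Filter.mem_cocompact.1 (h0.eventually (gt_mem_nhds (half_pos hpos)))
  obtain ⟨R, hR, hKR⟩ := hK.isBounded.subset_ball_lt 0 0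
  have hout : ∀ k, R ≤ ‖k‖ → U k < m / 2 := by
    intro k hk
    refine hKU fun hkK => ?_
    have := hKR hkK
    rw [Metric.mem_ball, dist_zero_right] at this
    linarith
  have hgR : ‖g‖ < R := by
    by_contra! h
    have := hout g h
    linarith
  have hsc : Continuous horSq := (contDiff_horSq (n := 0)).continuous
  obtain ⟨C, hC⟩ := (isCompact_closedBall (0 : H1) R).exists_bound_of_continuousOn hsc.continuousOn
  have hC0 : 0 ≤ C := (norm_nonneg _).trans (hC 0 (by simp [hR.le]))
  -- Small enough that d|z|² stays below m/2 on the closed ball, so on the sphere, where U < m/2,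
  -- the perturbed function is below m.
  set d := m / (2 * (C + 1)) with hd
  have hdpos : 0 < d := by positivity
  have hdC : d * C < m / 2 := by
    rw [hd, div_mul_eq_mul_div, div_lt_div_iff₀ (by positivity) (by positivity)]
    nlinarith
  set w : H1 → ℝ := fun k => U k + d * horSq k with hw
  have hwc : Continuous w := hc.add (continuous_const.mul hsc)
  obtain ⟨k, hkR, hk⟩ := (isCompact_closedBall (0 : H1) R).exists_isMaxOn
    ⟨0, by simp [hR.le]⟩ hwc.continuousOn
  have hwk : m ≤ w k := by
    have h1 : w g ≤ w k := hk (by simpa using hgR.le)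
    have h2 : m ≤ w g := by
      have := mul_nonneg hdpos.le (horSq_nonneg g)
      simp only [hw]; linarith
    linarith
  have hkint : ‖k‖ < R := by
    by_contra! h
    have h1 := hout k h
    have h2 := hC k hkR
    rw [Real.norm_of_nonneg (horSq_nonneg k)] at h2
    have h3 : d * horSq k ≤ d * C := by gcongr
    have h4 : w k = U k + d * horSq k := rfl
    linarith
  have hloc : IsLocalMax w k :=
    hk.isLocalMax (Metric.closedBall_mem_nhds_of_mem (by simpa using hkint))
  obtain ⟨D, S, hD, hS, hsum⟩ := hU k
  have hs' : ContDiff ℝ ∞ horSq := contDiff_horSq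
  have hle : ∀ i, S i + d * X i (X i horSq) k ≤ 0 := by
    intro i
    refine nonpos_of_isLocalMax (h := fun t => w (op k (t • e i)))
      (D := fun t => D i t + d * X i horSq (op k (t • e i))) (fun t => ?_) ?_ ?_
    · exact (hD i t).add ((hasDerivAt_comp_op (hs'.differentiable (by simp)) k t).const_mul d)
    · exact (hS i).add ((hasX_of_contDiff i (contDiff_X hs') k).const_mul d)
    · have hcont := (continuous_op_smul k i).continuousAt (x := 0)
      have : IsLocalMax w (op k ((0 : ℝ) • e i)) := by rwa [op_zero_smul]
      exact this.comp_continuous (g := fun t : ℝ => op k (t • e i)) hcont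
  have h4 := lap_horSq k
  rw [lap_eq] at h4
  nlinarith [hle 0, hle 1]

/-! ### Convolution with test functions -/

lemma op_neg_cancel (g h : H1) : op (op g h) (-h) = g := by
  ext <;> simp [op]; ring

lemma continuous_op : Continuous fun p : H1 × H1 => op p.1 p.2 := by
  unfold op; fun_prop

/-- Right translation by `v`. -/
def rightTranslation (v : H1) : H1 ≃ₜ H1 where
  toFun g := op g v
  invFun g := op g (-v)
  left_inv g := op_neg_cancel g v
  right_inv g := by simpa using op_neg_cancel g (-v)
  continuous_toFun := continuous_op.comp (continuous_id.prodMk continuous_const)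
  continuous_invFun := continuous_op.comp (continuous_id.prodMk continuous_const)

/-- The reflected left translation `k ↦ g ∘ k⁻¹`. -/
def reflectedTranslation (g : H1) : H1 ≃ₜ H1 where
  toFun k := op g (-k)
  invFun h := op (-h) g
  left_inv k := by ext <;> simp [op]; ring
  right_inv h := by ext <;> simp [op]; ring
  continuous_toFun := continuous_op.comp (continuous_const.prodMk continuous_neg)
  continuous_invFun := continuous_op.comp (continuous_neg.prodMk continuous_const)

lemma contDiff_op_neg (g : H1) : ContDiff ℝ ∞ fun k => op g (-k) := by
  unfold op; fun_prop

/-- Only φ is differentiated, as u is merely locally integrable. -/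
lemma hasDerivAt_integral_op {u φ : H1 → ℝ} (hu : LocallyIntegrable u) (hφ : ContDiff ℝ ∞ φ)
    (hs : HasCompactSupport φ) (i : Fin 2) (t : ℝ) :
    HasDerivAt (fun t : ℝ => ∫ k, u k * φ (op k (t • e i)))
      (∫ k, u k * X i φ (op k (t • e i))) t := by
  have hX := contDiff_X (i := i) hφ
  have hXs := hasCompactSupport_X (i := i) hφ hs
  have hint : ∀ {ψ : H1 → ℝ}, Continuous ψ → HasCompactSupport ψ → ∀ t : ℝ,
      Integrable fun k => u k * ψ (op k (t • e i)) := fun hψ hψs t =>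
    hu.integrable_smul_right_of_hasCompactSupport
      (hψ.comp (rightTranslation (t • e i)).continuous)
      (hψs.comp_homeomorph (rightTranslation (t • e i)))
  -- A compact set containing the supports of all differentiated integrands for times within 1 of t;
  -- it supports the dominating function.
  set K : Set H1 := (fun p : H1 × ℝ => op p.1 (-(p.2 • e i))) ''
    (tsupport (X i φ) ×ˢ Metric.closedBall t 1) with hK
  have hKc : IsCompact K := by
    refine (hXs.prod (isCompact_closedBall t 1)).image ?_
    exact continuous_op.comp (continuous_fst.prodMk (by fun_prop))
  obtain ⟨C, hC⟩ := hXs.exists_bound_of_continuous hX.continuous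
  refine (hasDerivAt_integral_of_dominated_loc_of_deriv_le
    (F := fun (t : ℝ) k => u k * φ (op k (t • e i)))
    (F' := fun (t : ℝ) k => u k * X i φ (op k (t • e i)))
    (bound := K.indicator fun k => ‖u k‖ * C)
    (Metric.closedBall_mem_nhds t one_pos) ?_ (hint hφ.continuous hs t)
    (hint hX.continuous hXs t).1 ?_ ?_ ?_).2
  · exact Filter.Eventually.of_forall fun t => (hint hφ.continuous hs t).1
  · refine Filter.Eventually.of_forall fun k s hsb => ?_
    by_cases hk : k ∈ K
    · rw [indicator_of_mem hk, norm_mul]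
      gcongr
      exact hC _
    · have hz : X i φ (op k (s • e i)) = 0 := by
        refine image_eq_zero_of_notMem_tsupport fun hmem => hk ?_
        exact ⟨(op k (s • e i), s), ⟨hmem, hsb⟩, op_neg_cancel _ _⟩
      rw [indicator_of_notMem hk, hz, mul_zero, norm_zero]
  · rw [integrable_indicator_iff hKc.measurableSet]
    exact ((hu.integrableOn_isCompact hKc).norm.mul_const C)
  · exact Filter.Eventually.of_forall fun k s _ =>
      (hasDerivAt_comp_op (hφ.differentiable (by simp)) k s).const_mul (u k)

/-- The group convolution of a test function with `u`. -/
def groupConv (η u : H1 → ℝ) (g : H1) : ℝ := ∫ k, u k * η (op g (-k))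

/-- Since g ∘ (t e_i) ∘ k⁻¹ = g ∘ (k ∘ (-t e_i))⁻¹, moving g along a left-invariant field moves k
along the same field backwards. The two signs cancel in second derivatives, and the sum is u tested
against Δ_H of φ(k) = η(g ∘ k⁻¹). -/
lemma isWeaklyHarmonic_groupConv {u η : H1 → ℝ} (hu : LocallyIntegrable u)
    (h0 : ∀ φ : H1 → ℝ, ContDiff ℝ ∞ φ → HasCompactSupport φ → ∫ g, u g * lap φ g = 0)
    (hη : ContDiff ℝ ∞ η) (hs : HasCompactSupport η) : IsWeaklyHarmonic (groupConv η u) := by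
  intro g
  set φ : H1 → ℝ := fun k => η (op g (-k)) with hφ
  have hφc : ContDiff ℝ ∞ φ := hη.comp (contDiff_op_neg g)
  have hφs : HasCompactSupport φ := hs.comp_homeomorph (reflectedTranslation g)
  have hconv : ∀ (i : Fin 2) (t : ℝ), groupConv η u (op g (t • e i)) =
      ∫ k, u k * φ (op k ((-t) • e i)) := by
    intro i t
    refine integral_congr_ae (Filter.Eventually.of_forall fun k => ?_)
    simp only [hφ]
    congr 2
    ext <;> simp [op] <;> ring
  refine ⟨fun i t => -∫ k, u k * X i φ (op k ((-t) • e i)),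
    fun i => ∫ k, u k * X i (X i φ) k, fun i t => ?_, fun i => ?_, ?_⟩
  · simp only [hconv]
    have := (hasDerivAt_integral_op hu hφc hφs i (-t)).scomp t (hasDerivAt_neg t)
    simpa [Function.comp_def] using this
  · have := ((hasDerivAt_integral_op (φ := X i φ) hu (contDiff_X hφc)
      (hasCompactSupport_X hφc hφs) i (-0)).scomp 0 (hasDerivAt_neg (0 : ℝ))).neg
    simp only [neg_zero, op_zero_smul, smul_eq_mul, neg_mul, one_mul, neg_neg] at this
    exact this
  · have h := h0 φ hφc hφs
    simp_rw [lap_eq, mul_add] at h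
    rw [integral_add] at h
    · exact h
    all_goals
      exact hu.integrable_smul_right_of_hasCompactSupport
        (contDiff_X (contDiff_X hφc)).continuous
        (hasCompactSupport_X (contDiff_X hφc) (hasCompactSupport_X hφc hφs))

lemma continuous_groupConv {u η : H1 → ℝ} (hu : LocallyIntegrable u)
    (hη : Continuous η) (hs : HasCompactSupport η) : Continuous (groupConv η u) := by
  rw [continuous_iff_continuousAt]
  intro g
  set K : Set H1 := (fun p : H1 × H1 => op (-p.1) p.2) '' (tsupport η ×ˢ Metric.closedBall g 1)
    with hK
  have hKc : IsCompact K := by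
    refine (hs.prod (isCompact_closedBall g 1)).image ?_
    exact continuous_op.comp (continuous_fst.neg.prodMk continuous_snd)
  have := continuousOn_integral_bilinear_of_locally_integrable_of_compact_support
    (ContinuousLinearMap.mul ℝ ℝ) (f := fun g k => η (op g (-k))) (s := Metric.closedBall g 1)
    hKc (hη.comp (continuous_op.comp
      (continuous_fst.prodMk continuous_snd.neg))).continuousOn ?_
    (hu.integrableOn_isCompact hKc)
  · exact this.continuousAt (Metric.closedBall_mem_nhds g one_pos)
  · intro h k hh hk
    refine image_eq_zero_of_notMem_tsupport fun hmem => hk ⟨(op h (-k), h), ⟨hmem, hh⟩, ?_⟩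
    exact (reflectedTranslation h).left_inv k

/-- Haar measure is invariant under inversion and translation. -/
lemma lintegral_comp_op_neg {F : H1 → ℝ≥0∞} (hF : Measurable F) (g : H1) :
    ∫⁻ k, F (op g (-k)) = ∫⁻ k, F k := by
  have hm : Measurable fun k : H1 => F (op g (-k)) :=
    hF.comp (contDiff_op_neg g).continuous.measurable
  symm
  rw [Measure.volume_eq_prod, lintegral_prod _ hm.aemeasurable, lintegral_prod _ hF.aemeasurable,
    ← lintegral_sub_left_eq_self _ g.1]
  refine lintegral_congr fun x => ?_
  rw [Measure.volume_eq_prod]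
  have h1 := lintegral_prod (μ := (volume : Measure ℝ)) (ν := (volume : Measure ℝ))
    (fun p : ℝ × ℝ => F (op g (-(x, p)))) (hm.comp measurable_prodMk_left).aemeasurable
  have h2 := lintegral_prod (μ := (volume : Measure ℝ)) (ν := (volume : Measure ℝ))
    (fun p : ℝ × ℝ => F (g.1 - x, p)) (hF.comp measurable_prodMk_left).aemeasurable
  rw [h2, h1, ← lintegral_sub_left_eq_self _ g.2.1]
  refine lintegral_congr fun y => ?_
  -- The map is triangular: once x and y are fixed, σ is only reflected and shifted by a constant.
  rw [← lintegral_sub_left_eq_self _ (g.2.2 + (g.1 * -y - g.2.1 * -x) / 2)]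
  refine lintegral_congr fun σ => ?_
  congr 1
  ext <;> simp [op] <;> ring

/-- For g far away, the support of k ↦ η(g ∘ k⁻¹) avoids the compact set where u is not small, while
its L¹ norm does not depend on g. -/
lemma tendsto_groupConv {u η : H1 → ℝ} (h0 : Filter.Tendsto u (Filter.cocompact H1) (𝓝 0))
    (hη : Continuous η) (hs : HasCompactSupport η) :
    Filter.Tendsto (groupConv η u) (Filter.cocompact H1) (𝓝 0) := by
  rw [Metric.tendsto_nhds]
  intro ε hε
  have hηr : ∀ g, Integrable fun k => η (op g (-k)) := fun g =>
    integrable_of_continuous (hη.comp (reflectedTranslation g).continuous)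
      (hs.comp_homeomorph (reflectedTranslation g))
  set M : ℝ := ∫ k, ‖η k‖ with hM
  have hMg : ∀ g, ∫ k, ‖η (op g (-k))‖ = M := by
    intro g
    rw [hM, integral_norm_eq_lintegral_enorm (hηr g).1,
      integral_norm_eq_lintegral_enorm hη.aestronglyMeasurable,
      lintegral_comp_op_neg (F := fun k => ‖η k‖ₑ) hη.measurable.enorm g]
  have hM0 : 0 ≤ M := integral_nonneg fun k => norm_nonneg _
  obtain ⟨K, hK, hKu⟩ := Filter.mem_cocompact.1
    ((Metric.tendsto_nhds.1 h0) (ε / (M + 1)) (by positivity))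
  set K' : Set H1 := (fun p : H1 × H1 => op p.1 p.2) '' (tsupport η ×ˢ K) with hK'
  have hKc' : IsCompact K' := (hs.prod hK).image continuous_op
  refine Filter.mem_cocompact.2 ⟨K', hKc', fun g hg => ?_⟩
  have hbound : ∀ k, ‖u k * η (op g (-k))‖ ≤ ε / (M + 1) * ‖η (op g (-k))‖ := by
    intro k
    rw [norm_mul]
    by_cases hk : k ∈ K
    · have hz : η (op g (-k)) = 0 := by
        refine image_eq_zero_of_notMem_tsupport fun hmem => hg ⟨(op g (-k), k), ⟨hmem, hk⟩, ?_⟩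
        simpa using op_neg_cancel g (-k)
      simp [hz]
    · have : dist (u k) 0 < ε / (M + 1) := hKu hk
      rw [dist_zero_right] at this
      gcongr
  show dist (groupConv η u g) 0 < ε
  rw [dist_zero_right]
  calc ‖groupConv η u g‖ ≤ ∫ k, ε / (M + 1) * ‖η (op g (-k))‖ :=
        norm_integral_le_of_norm_le ((hηr g).norm.const_mul _) (Filter.Eventually.of_forall hbound)
    _ = ε * (M / (M + 1)) := by rw [integral_const_mul, hMg]; ring
    _ < ε * 1 := by
        gcongr
        rw [div_lt_one (by positivity)]; linarith
    _ = ε := mul_one ε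

/-! ### Uniqueness of the fundamental solution -/

lemma ae_eq_zero_of_weakly_harmonic {u : H1 → ℝ} (hu : LocallyIntegrable u)
    (ht : Filter.Tendsto u (Filter.cocompact H1) (𝓝 0))
    (h0 : ∀ φ : H1 → ℝ, ContDiff ℝ ∞ φ → HasCompactSupport φ → ∫ g, u g * lap φ g = 0) :
    ∀ᵐ g, u g = 0 := by
  have hle : ∀ {v : H1 → ℝ}, LocallyIntegrable v →
      Filter.Tendsto v (Filter.cocompact H1) (𝓝 0) →
      (∀ φ : H1 → ℝ, ContDiff ℝ ∞ φ → HasCompactSupport φ → ∫ g, v g * lap φ g = 0) →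
      ∀ η : H1 → ℝ, ContDiff ℝ ∞ η → HasCompactSupport η → ∫ g, v g * η g ≤ 0 := by
    intro v hv hvt hv0 η hη hs
    -- With the reflected test function, the convolution at the identity is ∫ v η. Applying the
    -- bound to u and -u yields equality.
    set η' : H1 → ℝ := fun k => η (-k) with hη'
    have hc : ContDiff ℝ ∞ η' := hη.comp contDiff_neg
    have hs' : HasCompactSupport η' := hs.comp_homeomorph (Homeomorph.neg H1)
    have h := (isWeaklyHarmonic_groupConv hv hv0 hc hs').nonpos
      (continuous_groupConv hv hc.continuous hs') (tendsto_groupConv hvt hc.continuous hs') 0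
    have hop : ∀ k : H1, -(op 0 (-k)) = k := fun k => by ext <;> simp [op]
    simpa only [groupConv, hη', hop] using h
  refine ae_eq_zero_of_integral_contDiff_smul_eq_zero hu fun η hη hs => ?_
  have h1 := hle hu ht h0 η hη hs
  have h2 := hle (v := fun g => -u g) hu.neg (by simpa using ht.neg)
    (fun φ hφ hφs => by simp [integral_neg, h0 φ hφ hφs]) η hη hs
  simp only [neg_mul, integral_neg] at h2
  simp only [smul_eq_mul, mul_comm (η _)]
  linarith

/-- The fundamental solution vanishing at infinity is unique. -/
theorem IsFundamentalSolution.eq_fundSol {Γ : H1 → ℝ} (hΓ : IsFundamentalSolution Γ) {g : H1}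
    (hg : g ≠ 0) : Γ g = fundSol g := by
  have hF := isFundamentalSolution_fundSol
  have hae : ∀ᵐ g, Γ g - fundSol g = 0 := by
    refine ae_eq_zero_of_weakly_harmonic (hΓ.locallyIntegrable.sub hF.locallyIntegrable)
      (by simpa using hΓ.tendsto_zero.sub hF.tendsto_zero) fun φ hφ hs => ?_
    have hc := continuous_lap hφ
    have hcs := hasCompactSupport_lap hφ hs
    simp only [sub_mul]
    rw [integral_sub (f := fun g => Γ g * lap φ g) (g := fun g => fundSol g * lap φ g)
      (hΓ.locallyIntegrable.integrable_smul_right_of_hasCompactSupport hc hcs)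
      (hF.locallyIntegrable.integrable_smul_right_of_hasCompactSupport hc hcs),
      hΓ.neg_lap_eq_dirac φ hφ hs, hF.neg_lap_eq_dirac φ hφ hs, sub_self]
  have hae' : Γ =ᵐ[volume.restrict {0}ᶜ] fundSol := by
    refine ae_restrict_of_ae ?_
    filter_upwards [hae] with g hg using sub_eq_zero.1 hg
  exact Measure.eqOn_open_of_ae_eq hae' isOpen_compl_singleton hΓ.smooth.continuousOn
    hF.smooth.continuousOn hg

/-- As Q - 2 = 2, the exponent -1/2 turns κ⁻¹N⁻² into √κ N. -/
lemma gaugeOf_eq {Γ : H1 → ℝ} (hΓ : IsFundamentalSolution Γ) :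
    gaugeOf Γ = fun g => √kappa * koranyi g := by
  funext g
  unfold gaugeOf
  split_ifs with hg
  · simp [hg]
  · rw [hΓ.eq_fundSol hg, fundSol, Q, Real.mul_rpow (inv_pos.2 kappa_pos).le
      (Real.rpow_nonneg (koranyi_nonneg g) _), ← Real.rpow_mul (koranyi_nonneg g),
      Real.inv_rpow kappa_pos.le, ← Real.rpow_neg kappa_pos.le, Real.sqrt_eq_rpow]
    norm_num

/-! ### The density of the functionals -/

lemma ball_const_mul {b : ℝ} (hb : 0 < b) (r : ℝ) :
    ball (fun g => b * koranyi g) r = ball koranyi (r / b) := by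
  ext g
  simp only [ball, mem_ofPred_eq, lt_div_iff₀ hb, mul_comm]

/-- The identity element is discarded because the formula for |∇_H N|² is available only away from
it; the factors b^(α - 4) and b² combine. -/
lemma density_const_mul_ae {b : ℝ} (hb : 0 < b) (α : ℝ) (ψ : H1 → ℝ) :
    density (fun g => b * koranyi g) α ψ =ᵐ[volume] fun g => b ^ (α - 2) * (ψ g * weight α g) := by
  filter_upwards [compl_mem_ae_iff.2 (measure_singleton (0 : H1))] with g hg
  have hN := koranyi_pos hg
  rw [density, leftCarre_const_mul_koranyi b hg, Real.mul_rpow hb.le hN.le, Q, weight, div_eq_mul_inv,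
    mul_inv, ← Real.rpow_neg hb.le, ← Real.rpow_neg hN.le]
  have h1 : b ^ (α - 2) = b ^ (-(4 - α)) * b ^ 2 := by
    rw [← Real.rpow_natCast, ← Real.rpow_add hb]; norm_num; ring_nf
  have h2 : koranyi g ^ (α - 6) = koranyi g ^ (-(4 - α)) * koranyi g ^ (-2 : ℝ) := by
    rw [← Real.rpow_add hN]; ring_nf
  rw [h1, h2]; ring

lemma integrableOn_density {b : ℝ} (hb : 0 < b) {α r : ℝ} {ψ : H1 → ℝ}
    (h : IntegrableOn (fun g => ψ g * weight α g) (ball koranyi (r / b))) :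
    IntegrableOn (density (fun g => b * koranyi g) α ψ) (ball (fun g => b * koranyi g) r) := by
  rw [ball_const_mul hb]
  exact (h.const_mul (b ^ (α - 2))).congr (ae_restrict_of_ae (density_const_mul_ae hb α ψ).symm)

lemma setIntegral_density {b : ℝ} (hb : 0 < b) (α r : ℝ) (ψ : H1 → ℝ) :
    ∫ g in ball (fun g => b * koranyi g) r, density (fun g => b * koranyi g) α ψ g =
      b ^ (α - 2) * ∫ g in ball koranyi (r / b), ψ g * weight α g := by
  rw [ball_const_mul hb, ← integral_const_mul]
  exact integral_congr_ae (ae_restrict_of_ae (density_const_mul_ae hb α ψ))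

lemma weight_dil {l : ℝ} (hl : 0 < l) (α : ℝ) (g : H1) :
    weight α (dil l g) = l ^ (α - 4) * weight α g := by
  have h1 : horSq (dil l g) = l ^ 2 * horSq g := by simp only [horSq, dil_apply]; ring
  have h2 : l ^ (α - 4) = l ^ 2 * l ^ (α - 6) := by
    rw [← Real.rpow_natCast, ← Real.rpow_add hl]; norm_num; ring_nf
  rw [weight, weight, koranyi_dil hl.le, h1, h2, Real.mul_rpow hl.le (koranyi_nonneg g)]
  ring

/-- Weighted integrals of homogeneous polynomials over gauge balls. -/
lemma setIntegral_mul_weight {p : H1 → ℝ} {n : ℕ} (hp : ∀ l g, p (dil l g) = l ^ n * p g) (α : ℝ)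
    {q : ℝ} (hq : 0 < q) : ∫ g in ball koranyi q, p g * weight α g =
      q ^ α * q ^ n * ∫ g in ball koranyi 1, p g * weight α g := by
  rw [setIntegral_ball_of_homogeneous (m := n + (α - 4)) hq]
  · congr 1
    rw [← Real.rpow_natCast q n, ← Real.rpow_add hq]; ring_nf
  · intro g
    rw [hp, weight_dil hq, Real.rpow_add hq, Real.rpow_natCast]; ring

/-- Weighted integrals of polynomials with components of degree `0`, `2` and `4`. -/
lemma setIntegral_even_quartic {α : ℝ} (hα : 0 < α) {p ψ : H1 → ℝ} {w : H1 → ℝ}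
    (hp : Continuous p) (hψ : Continuous ψ)
    (hp2 : ∀ l g, p (dil l g) = l ^ 2 * p g) (hψ4 : ∀ l g, ψ (dil l g) = l ^ 4 * ψ g)
    (hw : ∀ g, w g = 1 + p g + ψ g) {q : ℝ} (hq : 0 < q) :
    ∫ g in ball koranyi q, w g * weight α g =
      q ^ α * ((∫ g in ball koranyi 1, weight α g) +
        q ^ 2 * (∫ g in ball koranyi 1, p g * weight α g) +
        q ^ 4 * ∫ g in ball koranyi 1, ψ g * weight α g) := by
  have h0 := integrableOn_mul_weight hα hq (ψ := fun _ => 1) continuous_const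
  have h2 := integrableOn_mul_weight hα hq hp
  have h4 := integrableOn_mul_weight hα hq hψ
  have e0 := setIntegral_mul_weight (p := fun _ => 1) (n := 0) (by simp) α hq
  simp only [one_mul, pow_zero, mul_one] at h0 e0
  simp only [hw, add_mul, one_mul]
  rw [integral_add (f := fun g => weight α g + p g * weight α g) (h0.add h2) h4,
    integral_add h0 h2, e0, setIntegral_mul_weight hp2 α hq,
    setIntegral_mul_weight hψ4 α hq]
  ring

/-! ### The left-invariant functional -/

lemma setIntegral_quartic_le {α : ℝ} (hα : 0 < α) :
    ∫ g in ball koranyi 1, (9 * horSq g ^ 2 + (6 * g.2.2 + 3 * (g.1 * g.2.1)) ^ 2) * weight α g ≤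
      63 / 4 * ∫ g in ball koranyi 1, horSq g * weight α g := by
  have hsc : Continuous horSq := (contDiff_horSq (n := 0)).continuous
  have hi : ∀ {ψ : H1 → ℝ}, Continuous ψ →
      IntegrableOn (fun g => ψ g * weight α g) (ball koranyi 1) :=
    fun hψ => integrableOn_mul_weight hα one_pos hψ
  have hm := measurableSet_ball_koranyi 1
  calc ∫ g in ball koranyi 1, (9 * horSq g ^ 2 + (6 * g.2.2 + 3 * (g.1 * g.2.1)) ^ 2) * weight α g
      ≤ ∫ g in ball koranyi 1, (27 / 2 * (horSq g ^ 2 * weight α g) +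
          9 / 2 * ((4 * g.2.2) ^ 2 * weight α g)) := by
        refine setIntegral_mono (hi (by fun_prop)) (((hi (by fun_prop)).const_mul _).add
          ((hi (by fun_prop)).const_mul _)) fun g => ?_
        -- From (u + v)² ≤ 2u² + 2v² and x²y² ≤ |z|⁴/4. The moment identity then gives 27/2 +
        -- (9/2)(1/2) = 63/4.
        have h1 : 9 * horSq g ^ 2 + (6 * g.2.2 + 3 * (g.1 * g.2.1)) ^ 2 ≤
            27 / 2 * horSq g ^ 2 + 9 / 2 * (4 * g.2.2) ^ 2 := by
          unfold horSq
          nlinarith [sq_nonneg (6 * g.2.2 - 3 * (g.1 * g.2.1)), sq_nonneg (g.1 ^ 2 - g.2.1 ^ 2)]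
        calc _ ≤ (27 / 2 * horSq g ^ 2 + 9 / 2 * (4 * g.2.2) ^ 2) * weight α g :=
              mul_le_mul_of_nonneg_right h1 (weight_nonneg α g)
          _ = _ := by ring
    _ = 63 / 4 * ∫ g in ball koranyi 1, horSq g ^ 2 * weight α g := by
        rw [integral_add ((hi (by fun_prop)).const_mul _) ((hi (by fun_prop)).const_mul _),
          integral_const_mul, integral_const_mul, ← two_mul_setIntegral_vertical α]
        ring
    _ ≤ 63 / 4 * ∫ g in ball koranyi 1, horSq g * weight α g := by
        refine mul_le_mul_of_nonneg_left (setIntegral_mono_on (hi (by fun_prop)) (hi hsc) hm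
          fun g hg => mul_le_mul_of_nonneg_right ?_ (weight_nonneg α g)) (by norm_num)
        have h1 : koranyi g < 1 := hg
        have h2 := horSq_le_koranyi_sq g
        have h3 := koranyi_nonneg g
        have h4 : horSq g ≤ 1 := h2.trans (pow_le_one₀ h3 h1.le)
        nlinarith [horSq_nonneg g]

lemma leftFunctional_eq {b : ℝ} (hb : 0 < b) {α r : ℝ} (hα : 0 < α) (hr : 0 < r) :
    leftFunctional (fun g => b * koranyi g) α f r = (b ^ 2)⁻¹ *
      ((∫ g in ball koranyi 1, weight α g) -
        6 * (r / b) ^ 2 * (∫ g in ball koranyi 1, horSq g * weight α g) +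
        (r / b) ^ 4 * ∫ g in ball koranyi 1,
          (9 * horSq g ^ 2 + (6 * g.2.2 + 3 * (g.1 * g.2.1)) ^ 2) * weight α g) := by
  have hsc : Continuous horSq := (contDiff_horSq (n := 0)).continuous
  have hq : 0 < r / b := by positivity
  have h := setIntegral_even_quartic hα (w := leftCarre f) (p := fun g => -6 * horSq g)
    (ψ := fun g => 9 * horSq g ^ 2 + (6 * g.2.2 + 3 * (g.1 * g.2.1)) ^ 2)
    (by fun_prop) (by fun_prop) (fun l g => by simp only [horSq, dil_apply]; ring)
    (fun l g => by simp only [horSq, dil_apply]; ring)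
    (fun g => by rw [leftCarre_f]; simp only [horSq]; ring) hq
  rw [leftFunctional, setIntegral_density hb, h]
  simp only [mul_assoc (-6 : ℝ)]
  rw [integral_const_mul]
  have h1 : 1 / r ^ α * (b ^ (α - 2) * (r / b) ^ α) = (b ^ 2)⁻¹ := by
    rw [Real.div_rpow hr.le hb.le, Real.rpow_sub hb, Real.rpow_two]
    have := (Real.rpow_pos_of_pos hr α).ne'
    have := (Real.rpow_pos_of_pos hb α).ne'
    field_simp
  rw [← h1]; ring

lemma antitoneOn_leftFunctional {b : ℝ} (hb : 0 < b) (hb2 : 7 / 12 ≤ b ^ 2) {α : ℝ} (hα : 0 < α) :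
    AntitoneOn (fun r => leftFunctional (fun g => b * koranyi g) α f r) (Ioo 0 (1 / 3)) := by
  intro r hr t ht hrt
  simp only
  rw [leftFunctional_eq hb hα hr.1, leftFunctional_eq hb hα ht.1]
  refine mul_le_mul_of_nonneg_left ?_ (by positivity)
  have hle := setIntegral_quartic_le hα
  have h2 : 0 ≤ ∫ g in ball koranyi 1, horSq g * weight α g :=
    integral_nonneg fun g => mul_nonneg (horSq_nonneg g) (weight_nonneg α g)
  set a₂ := ∫ g in ball koranyi 1, horSq g * weight α g
  set a₄ := ∫ g in ball koranyi 1,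
    (9 * horSq g ^ 2 + (6 * g.2.2 + 3 * (g.1 * g.2.1)) ^ 2) * weight α g
  -- 4/21 = (1/9)/(7/12).
  have hsq : ∀ {s : ℝ}, s ∈ Ioo (0 : ℝ) (1 / 3) → (s / b) ^ 2 ≤ 4 / 21 := by
    intro s hs
    rw [div_pow, div_le_iff₀ (by positivity)]
    nlinarith [hs.1, hs.2]
  have hmono : (r / b) ^ 2 ≤ (t / b) ^ 2 := by
    have := hr.1
    gcongr
  -- Sharp use of the constants: (63/4) · 2 · (4/21) = 6.
  have h3 : a₄ * ((r / b) ^ 2 + (t / b) ^ 2) ≤ 6 * a₂ := by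
    have : a₄ * ((r / b) ^ 2 + (t / b) ^ 2) ≤ (63 / 4 * a₂) * ((r / b) ^ 2 + (t / b) ^ 2) :=
      mul_le_mul_of_nonneg_right hle (by positivity)
    nlinarith [hsq hr, hsq ht]
  nlinarith [mul_nonneg (sub_nonneg.2 hmono) (sub_nonneg.2 h3)]

/-! ### The right-invariant carré du champ -/

lemma rightCarre_f (g : H1) : rightCarre f g =
    (1 - 3 * g.1 ^ 2 + 3 * g.2.1 ^ 2) ^ 2 + (6 * g.2.2 - 3 * (g.1 * g.2.1)) ^ 2 := by
  have hx : HasDerivAt (fun t : ℝ => t + g.1) 1 0 := (hasDerivAt_id (0 : ℝ)).add_const g.1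
  have hy : HasDerivAt (fun t : ℝ => t + g.2.1) 1 0 := (hasDerivAt_id (0 : ℝ)).add_const g.2.1
  have hσ0 : HasDerivAt (fun t : ℝ => g.2.2 + t * g.2.1 / 2) (1 * g.2.1 / 2) 0 :=
    (((hasDerivAt_id (0 : ℝ)).mul_const g.2.1).div_const 2).const_add g.2.2
  have hσ1 : HasDerivAt (fun t : ℝ => g.2.2 + -(t * g.1) / 2) (-(1 * g.1) / 2) 0 :=
    (((hasDerivAt_id (0 : ℝ)).mul_const g.1).neg.div_const 2).const_add g.2.2
  have h0 : Xr 0 f g = 1 - 3 * g.1 ^ 2 + 3 * g.2.1 ^ 2 := by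
    have : (fun t : ℝ => f (op (t • e 0) g)) = fun t => (t + g.1) +
        6 * g.2.1 * (g.2.2 + t * g.2.1 / 2) - (t + g.1) ^ 3 := by
      funext t; simp [f, op, e_zero]
    have hd : HasDerivAt (fun t => (t + g.1) + 6 * g.2.1 * (g.2.2 + t * g.2.1 / 2) -
      (t + g.1) ^ 3) _ 0 := (hx.add (hσ0.const_mul _)).sub (hx.pow 3)
    rw [Xr, this, hd.deriv]
    norm_num; ring
  have h1 : Xr 1 f g = 6 * g.2.2 - 3 * (g.1 * g.2.1) := by
    have : (fun t : ℝ => f (op (t • e 1) g)) = fun t => g.1 +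
        6 * ((t + g.2.1) * (g.2.2 + -(t * g.1) / 2)) - g.1 ^ 3 := by
      funext t; simp [f, op, e_one]; ring
    have hd : HasDerivAt (fun t => g.1 + 6 * ((t + g.2.1) * (g.2.2 + -(t * g.1) / 2)) -
      g.1 ^ 3) _ 0 := (((hy.mul hσ1).const_mul 6).const_add g.1).sub_const _
    rw [Xr, this, hd.deriv]
    norm_num; ring
  rw [rightCarre_eq, h0, h1]

lemma op_smul_zero (v g : H1) : op ((0 : ℝ) • v) g = g := by ext <;> simp [op]

lemma continuous_op_smul_left (g : H1) (i : Fin 2) : Continuous fun t : ℝ => op (t • e i) g :=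
  continuous_op.comp ((continuous_id.smul continuous_const).prodMk continuous_const)

/-- The right-invariant derivative of a positive part, with the junk value `0` on the free
boundary. -/
lemma Xr_max_zero (i : Fin 2) {h : H1 → ℝ} (hc : Continuous h) (g : H1) :
    Xr i (fun g => max (h g) 0) g = if 0 < h g then Xr i h g else 0 := by
  split_ifs with hg
  · refine Filter.EventuallyEq.deriv_eq ?_
    have hcont : Continuous fun t : ℝ => h (op (t • e i) g) := hc.comp (continuous_op_smul_left g i)
    have : ∀ᶠ t in 𝓝 (0 : ℝ), 0 < h (op (t • e i) g) :=
      hcont.continuousAt.eventually (lt_mem_nhds (by simpa only [op_smul_zero] using hg))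
    filter_upwards [this] with t ht using max_eq_left ht.le
  -- Where h ≤ 0 the positive part attains its minimum 0, so `deriv` vanishes whether or not the
  -- derivative exists.
  · refine IsLocalMin.deriv_eq_zero (Filter.Eventually.of_forall fun t => ?_)
    simp only [op_smul_zero, max_eq_right (not_lt.1 hg)]
    exact le_max_right _ _

lemma rightCarre_max_zero {h : H1 → ℝ} (hc : Continuous h) :
    rightCarre (fun g => max (h g) 0) = {g | 0 < h g}.indicator (rightCarre h) := by
  funext g
  rw [rightCarre_eq, Xr_max_zero 0 hc, Xr_max_zero 1 hc]
  by_cases hg : 0 < h g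
  · rw [indicator_of_mem (by exact hg), if_pos hg, if_pos hg, rightCarre_eq]
  · rw [indicator_of_notMem (by exact hg), if_neg hg, if_neg hg]; norm_num

lemma rightCarre_neg (h : H1 → ℝ) : rightCarre (fun g => -h g) = rightCarre h := by
  funext g
  have : ∀ i, Xr i (fun g => -h g) g = -Xr i h g := fun i => deriv.fun_neg
  rw [rightCarre_eq, rightCarre_eq, this, this]; ring

lemma continuous_f : Continuous f := (contDiff_f (n := 0)).continuous

lemma rightCarre_fPos : rightCarre fPos = {g | 0 < f g}.indicator (rightCarre f) :=
  rightCarre_max_zero continuous_f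

lemma rightCarre_fNeg : rightCarre fNeg = {g | f g < 0}.indicator (rightCarre f) := by
  have h := rightCarre_max_zero (h := fun g => -f g) continuous_f.neg
  rw [rightCarre_neg] at h
  simp only [neg_pos] at h
  exact h

lemma continuous_rightCarre_f : Continuous (rightCarre f) := by
  simp only [funext rightCarre_f]; fun_prop

/-- For y ≠ 0 the equation f = 0 is linear in σ, so by Fubini almost every vertical fibre contains
one point. The two phases thus miss only a null set. -/
lemma volume_zeroSet_f : volume {g : H1 | f g = 0} = 0 := by
  have hm : MeasurableSet {g : H1 | f g = 0} :=
    measurableSet_eq_fun continuous_f.measurable measurable_const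
  rw [Measure.volume_eq_prod, Measure.measure_prod_null hm]
  refine Filter.Eventually.of_forall fun x => ?_
  have hmx : MeasurableSet (Prod.mk x ⁻¹' {g : H1 | f g = 0}) := measurable_prodMk_left hm
  simp only [Pi.zero_apply]
  rw [Measure.volume_eq_prod, Measure.measure_prod_null hmx]
  filter_upwards [compl_mem_ae_iff.2 (measure_singleton (0 : ℝ))] with y hy
  have hy' : y ≠ 0 := hy
  refine measure_mono_null (t := {(x ^ 3 - x) / (6 * y)}) (fun σ hσ => ?_) (measure_singleton _)
  have : x + 6 * y * σ - x ^ 3 = 0 := hσ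
  rw [mem_singleton_iff, eq_div_iff (by positivity)]
  linarith

/-! ### Symmetries of the gauge -/

lemma setIntegral_ball_comp {T : H1 → H1} (hT : MeasurePreserving T) (hTe : MeasurableEmbedding T)
    (hN : ∀ g, koranyi (T g) = koranyi g) (q : ℝ) (h : H1 → ℝ) :
    ∫ g in ball koranyi q, h (T g) = ∫ g in ball koranyi q, h g := by
  have : ball koranyi q = T ⁻¹' ball koranyi q := by
    ext g; simp only [ball, mem_preimage, mem_ofPred_eq, hN]
  conv_lhs => rw [this]
  exact hT.setIntegral_preimage_emb hTe h _

/-- The involution `(x, y, σ) ↦ (-x, y, -σ)`. -/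
def reflection (g : H1) : H1 := (-g.1, g.2.1, -g.2.2)

lemma measurePreserving_reflection : MeasurePreserving reflection :=
  (Measure.measurePreserving_neg (volume : Measure ℝ)).prod
    ((MeasurePreserving.id (volume : Measure ℝ)).prod
      (Measure.measurePreserving_neg (volume : Measure ℝ)))

lemma measurableEmbedding_of_involutive {T : H1 → H1} (hT : Continuous T)
    (hi : Function.Involutive T) : MeasurableEmbedding T :=
  hT.measurableEmbedding hi.injective

lemma measurableEmbedding_reflection : MeasurableEmbedding reflection :=
  measurableEmbedding_of_involutive (by unfold reflection; fun_prop)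
    fun g => by simp [reflection]

/-- The involution `(x, y, σ) ↦ (y, x, σ)`. -/
def exchange (g : H1) : H1 := (g.2.1, g.1, g.2.2)

lemma measurePreserving_exchange : MeasurePreserving exchange := by
  have h1 : MeasurePreserving (MeasurableEquiv.prodAssoc : (ℝ × ℝ) × ℝ ≃ᵐ ℝ × ℝ × ℝ) :=
    volume_preserving_prodAssoc
  have h2 : MeasurePreserving (Prod.map Prod.swap id : (ℝ × ℝ) × ℝ → (ℝ × ℝ) × ℝ) :=
    (Measure.measurePreserving_swap (μ := (volume : Measure ℝ)) (ν := (volume : Measure ℝ))).prod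
      (MeasurePreserving.id (volume : Measure ℝ))
  exact h1.comp (h2.comp h1.symm)

lemma measurableEmbedding_exchange : MeasurableEmbedding exchange :=
  measurableEmbedding_of_involutive (by unfold exchange; fun_prop) fun _ => rfl

/-! ### The two-phase functional -/

lemma integrableOn_rightCarre_indicator {S : Set H1} (hS : MeasurableSet S) {q : ℝ} (hq : 0 < q) :
    IntegrableOn (fun g => S.indicator (rightCarre f) g * weight 2 g) (ball koranyi q) := by
  have h := (integrableOn_mul_weight (α := 2) two_pos hq continuous_rightCarre_f).indicator hS
  refine h.congr (Filter.Eventually.of_forall fun g => ?_)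
  simp only [indicator_mul_left]

lemma measurableSet_f_pos : MeasurableSet {g : H1 | 0 < f g} :=
  measurableSet_lt measurable_const continuous_f.measurable

lemma measurableSet_f_neg : MeasurableSet {g : H1 | f g < 0} :=
  measurableSet_lt continuous_f.measurable measurable_const

/-- `reflection` preserves the measure, the gauge, the weight and `rightCarre f`, and sends f to -f,
hence interchanges the phases. -/
lemma setIntegral_rightCarre_fNeg (q : ℝ) :
    ∫ g in ball koranyi q, rightCarre fNeg g * weight 2 g =
      ∫ g in ball koranyi q, rightCarre fPos g * weight 2 g := by
  have hN : ∀ g, koranyi (reflection g) = koranyi g := fun g => by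
    simp [koranyi, reflection]
  rw [← setIntegral_ball_comp measurePreserving_reflection measurableEmbedding_reflection hN]
  congr 1
  funext g
  have hw : weight 2 (reflection g) = weight 2 g := by
    rw [weight, weight, hN]; simp [horSq, reflection]
  have hf : f (reflection g) = -f g := by simp only [f, reflection]; ring
  have hr : rightCarre f (reflection g) = rightCarre f g := by
    rw [rightCarre_f, rightCarre_f]; simp only [reflection]; ring
  rw [hw, rightCarre_fNeg, rightCarre_fPos]
  congr 1
  by_cases hg : 0 < f g
  · simp [hf, hr, hg]
  · simp [hf, hg]

lemma two_mul_setIntegral_rightCarre_fPos {q : ℝ} (hq : 0 < q) :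
    2 * ∫ g in ball koranyi q, rightCarre fPos g * weight 2 g =
      ∫ g in ball koranyi q, rightCarre f g * weight 2 g := by
  rw [two_mul]
  nth_rewrite 2 [← setIntegral_rightCarre_fNeg]
  rw [rightCarre_fPos, rightCarre_fNeg,
    ← integral_add (integrableOn_rightCarre_indicator measurableSet_f_pos hq)
      (integrableOn_rightCarre_indicator measurableSet_f_neg hq)]
  refine integral_congr_ae (ae_restrict_of_ae ?_)
  filter_upwards [compl_mem_ae_iff.2 volume_zeroSet_f] with g hg
  rcases lt_or_gt_of_ne (show f g ≠ 0 from hg) with h | h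
  · simp [h, h.not_gt]
  · simp [h, h.not_gt]

/-- The quadratic part 6(y² - x²) is odd under `exchange`, which preserves the weight and the ball,
so it integrates to zero. -/
lemma setIntegral_rightCarre_f {q : ℝ} (hq : 0 < q) :
    ∫ g in ball koranyi q, rightCarre f g * weight 2 g =
      q ^ 2 * ((∫ g in ball koranyi 1, weight 2 g) + q ^ 4 * ∫ g in ball koranyi 1,
        (9 * (g.1 ^ 2 - g.2.1 ^ 2) ^ 2 + (6 * g.2.2 - 3 * (g.1 * g.2.1)) ^ 2) * weight 2 g) := by
  have h := setIntegral_even_quartic (α := 2) two_pos (w := rightCarre f)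
    (p := fun g => 6 * (g.2.1 ^ 2 - g.1 ^ 2))
    (ψ := fun g => 9 * (g.1 ^ 2 - g.2.1 ^ 2) ^ 2 + (6 * g.2.2 - 3 * (g.1 * g.2.1)) ^ 2)
    (by fun_prop) (by fun_prop) (fun l g => by simp only [dil_apply]; ring)
    (fun l g => by simp only [dil_apply]; ring) (fun g => by rw [rightCarre_f]; ring) hq
  have hN : ∀ g, koranyi (exchange g) = koranyi g := fun g => by
    simp [koranyi, exchange, add_comm]
  have h0 := setIntegral_ball_comp measurePreserving_exchange measurableEmbedding_exchange hN 1
    fun g => 6 * (g.2.1 ^ 2 - g.1 ^ 2) * weight 2 g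
  have h1 : ∀ g, 6 * ((exchange g).2.1 ^ 2 - (exchange g).1 ^ 2) * weight 2 (exchange g) =
      -(6 * (g.2.1 ^ 2 - g.1 ^ 2) * weight 2 g) := by
    intro g
    have hw : weight 2 (exchange g) = weight 2 g := by
      rw [weight, weight, hN]; simp [horSq, exchange, add_comm]
    rw [hw]; simp only [exchange]; ring
  simp_rw [h1] at h0
  rw [integral_neg] at h0
  have h2 : ∫ g in ball koranyi 1, 6 * (g.2.1 ^ 2 - g.1 ^ 2) * weight 2 g = 0 := by linarith
  rw [h, h2, Real.rpow_two]
  ring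

lemma monotoneOn_twoPhase {b : ℝ} (hb : 0 < b) :
    MonotoneOn (fun r => twoPhase (fun g => b * koranyi g) fPos fNeg r) (Ioi 0) := by
  have key : ∀ r ∈ Ioi (0 : ℝ), twoPhase (fun g => b * koranyi g) fPos fNeg r =
      ((b ^ 2)⁻¹ / 2 * ((∫ g in ball koranyi 1, weight 2 g) + (r / b) ^ 4 * ∫ g in ball koranyi 1,
        (9 * (g.1 ^ 2 - g.2.1 ^ 2) ^ 2 + (6 * g.2.2 - 3 * (g.1 * g.2.1)) ^ 2) * weight 2 g)) ^ 2 := by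
    intro r hr
    have hr0 : 0 < r := hr
    have hq : 0 < r / b := by positivity
    rw [twoPhase, setIntegral_density hb, setIntegral_density hb, setIntegral_rightCarre_fNeg]
    have h1 := two_mul_setIntegral_rightCarre_fPos hq
    rw [setIntegral_rightCarre_f hq] at h1
    rw [sub_self, Real.rpow_zero, one_mul]
    rw [eq_div_of_mul_eq two_ne_zero ((mul_comm _ _).trans h1)]
    generalize ∫ g in ball koranyi 1, weight 2 g = a
    generalize ∫ g in ball koranyi 1,
      (9 * (g.1 ^ 2 - g.2.1 ^ 2) ^ 2 + (6 * g.2.2 - 3 * (g.1 * g.2.1)) ^ 2) * weight 2 g = c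
    field_simp
  intro r hr t ht hrt
  simp only
  rw [key r hr, key t ht]
  have hr0 : 0 < r := hr
  have h0 : 0 ≤ ∫ g in ball koranyi 1, weight 2 g := integral_nonneg fun g => weight_nonneg 2 g
  have h4 : 0 ≤ ∫ g in ball koranyi 1,
      (9 * (g.1 ^ 2 - g.2.1 ^ 2) ^ 2 + (6 * g.2.2 - 3 * (g.1 * g.2.1)) ^ 2) * weight 2 g :=
    integral_nonneg fun g => mul_nonneg (by positivity) (weight_nonneg 2 g)
  gcongr

lemma eq_const_mul_koranyi {ρ : H1 → ℝ}
    (hρ : (∃ Γ : H1 → ℝ, IsFundamentalSolution Γ ∧ ρ = gaugeOf Γ) ∨ ρ = koranyi) :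
    ∃ b : ℝ, 0 < b ∧ 7 / 12 ≤ b ^ 2 ∧ ρ = fun g => b * koranyi g := by
  rcases hρ with ⟨Γ, hΓ, rfl⟩ | rfl
  · exact ⟨√kappa, Real.sqrt_pos.2 kappa_pos, by rw [Real.sq_sqrt kappa_pos.le]; exact kappa_ge,
      gaugeOf_eq hΓ⟩
  · exact ⟨1, one_pos, by norm_num, by simp⟩

end Heisenberg

end

theorem proposition1p3 :
    Heisenberg.IsHarmonic Heisenberg.f ∧
    (∀ x y σ : ℝ, Heisenberg.lap (Heisenberg.leftCarre Heisenberg.f) (x, y, σ)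
      = 216 * x ^ 2 + 144 * y ^ 2 - 24) ∧
    (∀ x y σ : ℝ, x ^ 2 + y ^ 2 ≤ 1 / 9 →
      Heisenberg.lap (Heisenberg.leftCarre Heisenberg.f) (x, y, σ) ≤ 0) ∧
    (∃ Γ : Heisenberg.H1 → ℝ, Heisenberg.IsFundamentalSolution Γ) ∧
    (∀ ρ : Heisenberg.H1 → ℝ,
      ((∃ Γ : Heisenberg.H1 → ℝ, Heisenberg.IsFundamentalSolution Γ ∧ ρ = Heisenberg.gaugeOf Γ) ∨
        ρ = Heisenberg.koranyi) →
      (∀ α : ℝ, 0 < α → α < Heisenberg.Q →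
        (∀ r : ℝ, 0 < r → MeasureTheory.IntegrableOn
          (Heisenberg.density ρ α (Heisenberg.leftCarre Heisenberg.f))
          (Heisenberg.ball ρ r) MeasureTheory.volume) ∧
        AntitoneOn (fun r : ℝ => Heisenberg.leftFunctional ρ α Heisenberg.f r)
          (Set.Ioo 0 (1 / 3))) ∧
      (∀ r : ℝ, 0 < r →
        MeasureTheory.IntegrableOn
          (Heisenberg.density ρ 2 (Heisenberg.rightCarre Heisenberg.fPos))
          (Heisenberg.ball ρ r) MeasureTheory.volume ∧
        MeasureTheory.IntegrableOn
          (Heisenberg.density ρ 2 (Heisenberg.rightCarre Heisenberg.fNeg))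
          (Heisenberg.ball ρ r) MeasureTheory.volume) ∧
      MonotoneOn (fun r : ℝ => Heisenberg.twoPhase ρ Heisenberg.fPos Heisenberg.fNeg r)
        (Set.Ioi 0)) := by
  refine ⟨Heisenberg.isHarmonic_f, Heisenberg.lap_leftCarre_f, fun x y σ h => ?_,
    ⟨_, Heisenberg.isFundamentalSolution_fundSol⟩, fun ρ hρ => ?_⟩
  · rw [Heisenberg.lap_leftCarre_f]
    -- 216x² + 144y² ≤ 216(x² + y²) ≤ 24.
    nlinarith [sq_nonneg y]
  obtain ⟨b, hb, hb2, rfl⟩ := Heisenberg.eq_const_mul_koranyi hρ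
  refine ⟨fun α hα _ => ⟨fun r hr => ?_, Heisenberg.antitoneOn_leftFunctional hb hb2 hα⟩,
    fun r hr => ⟨?_, ?_⟩, Heisenberg.monotoneOn_twoPhase hb⟩
  · refine Heisenberg.integrableOn_density hb
      (Heisenberg.integrableOn_mul_weight hα (div_pos hr hb) ?_)
    rw [Heisenberg.leftCarre_f]
    fun_prop
  · refine Heisenberg.integrableOn_density hb ?_
    rw [Heisenberg.rightCarre_fPos]
    exact Heisenberg.integrableOn_rightCarre_indicator Heisenberg.measurableSet_f_pos (div_pos hr hb)
  · refine Heisenberg.integrableOn_density hb ?_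
    rw [Heisenberg.rightCarre_fNeg]
    exact Heisenberg.integrableOn_rightCarre_indicator Heisenberg.measurableSet_f_neg (div_pos hr hb)
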